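/- For a pseudo-Riemannian manifold $(N,h)$ of dimension $m$ with Levi-Civita connection $\nabla$, let $$\mathcal R(X,Y)Z=\nabla_Y\nabla_XZ-\nabla_X\nabla_YZ+\nabla_{[X,Y]}Z,\qquad \mathcal R(X,Y,Z,V)=h(\mathcal R(X,Y)Z,V),$$ let $\mathrm{Ric}(X,Y)=\operatorname{tr}\big(V\mapsto \mathcal R(X,V)Y\big)$, let $\tau$ be the scalar curvature (the $h$-trace of $\mathrm{Ric}$), and let $$\mathcal C(X,Y)Z=\mathcal R(X,Y)Z-\frac{\tau}{m(m-1)}\big[h(X,Z)Y-h(Y,Z)X\big]$$ be the concircular curvature tensor (for $m\le 1$ it is $0$). It is called divergence free if $\operatorname{tr}\big(V\mapsto(\nabla_V\mathcal C)(X,Y)Z\big)=0$ for all $X,Y,Z$. The manifold $(N,h)$ is called Einstein if $\mathrm{Ric}=c\,h$ for some constant $c\in\mathbb R$. **Theorem.** Let $(M_1,g_1)$ and $(M_2,g_2)$ be non-empty smooth pseudo-Riemannian manifolds without boundary, of dimensions $n_1,n_2$ with $n_1+n_2\ge 3$, and let $M_1$ be connected. Let $f\colon M_1\to(0,\infty)$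 be smooth, and let $M=M_1\times_fM_2$ be the warped product, i.e. $M_1\times M_2$ with the metric $g=\pi_1^*g_1+(f\circ\pi_1)^2\,\pi_2^*g_2$, where $\pi_i\colon M_1\times M_2\to M_i$ are the projections. Let $\mathcal C$, $\mathcal C^1$, $\mathcal C^2$ be the concircular curvature tensors of $g$, $g_1$, $g_2$, let $\mathcal R^1$ be the curvature tensor of $g_1$, and let $\mathcal F=\frac1fH^f$, where $H^f(Y,Z)=g_1(\nabla^1_Y\operatorname{grad}f,Z)$ is the Hessian of $f$ on $(M_1,g_1)$. Assume that $\mathcal C$ is divergence free. Then: 1. $\mathcal C^1$ is divergence free if $$\mathcal R^1(X,Y,\operatorname{grad}f,Z)=Y(f)\,\mathcal F(X,Z)-X(f)\,\mathcal F(Y,Z)\quad\text{for all vector fields }X,Y,Z\text{ on }M_1;$$ 2. $\mathcal C^2$ is divergence free; 3. $f$ is constant or $(M_2,g_2)$ is Einstein. -/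

import Mathlib

set_option maxSynthPendingDepth 3

open Set
open scoped Manifold ContDiff Topology

noncomputable section

/-! ## Tensor calculus on an open piece of a finite-dimensional vector space

`G : E → (E →L[ℝ] E →L[ℝ] ℝ)` is the coordinate expression of a metric.  Vectors `X Y Z : E` are
read as the constant (coordinate) vector fields, whose Lie brackets vanish. -/

namespace LocalGeometry

variable {E : Type*} [NormedAddCommGroup E] [NormedSpace ℝ E]

/-- The trace of an endomorphism, as a continuous linear functional. -/
def traceCLM (E : Type*) [NormedAddCommGroup E] [NormedSpace ℝ E] [FiniteDimensional ℝ E] :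
    (E →L[ℝ] E) →L[ℝ] ℝ :=
  LinearMap.toContinuousLinearMap
    ((LinearMap.trace ℝ E).comp (ContinuousLinearMap.coeLM ℝ : (E →L[ℝ] E) →ₗ[ℝ] (E →ₗ[ℝ] E)))

theorem traceCLM_apply [FiniteDimensional ℝ E] (T : E →L[ℝ] E) : traceCLM E T = LinearMap.trace ℝ E (T : E →ₗ[ℝ] E) := rfl

/-- The exchange of the two arguments of a bilinear map, as a continuous linear map. -/
def flipCLM (E F : Type*) [NormedAddCommGroup E] [NormedSpace ℝ E] [NormedAddCommGroup F]
    [NormedSpace ℝ F] : (E →L[ℝ] E →L[ℝ] F) →L[ℝ] (E →L[ℝ] E →L[ℝ] F) :=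
  LinearMap.mkContinuous
    ({ toFun := fun B => B.flip
       map_add' := fun _ _ => rfl
       map_smul' := fun _ _ => rfl } : (E →L[ℝ] E →L[ℝ] F) →ₗ[ℝ] (E →L[ℝ] E →L[ℝ] F)) 1
    (fun B => by rw [one_mul]; exact B.opNorm_flip.le)

theorem flipCLM_apply {F : Type*} [NormedAddCommGroup F] [NormedSpace ℝ F]
    (B : E →L[ℝ] E →L[ℝ] F) (u v : E) : flipCLM E F B u v = B v u := rfl

/-- The Christoffel symbols of the first kind, see `christoffelLower_apply`. -/
def christoffelLower (G : E → E →L[ℝ] E →L[ℝ] ℝ) (x : E) : E →L[ℝ] E →L[ℝ] E →L[ℝ] ℝ :=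
  let D : E →L[ℝ] E →L[ℝ] E →L[ℝ] ℝ := fderiv ℝ G x
  let K : E →L[ℝ] E →L[ℝ] E →L[ℝ] ℝ := (flipCLM E ℝ).comp D.flip
  (1 / 2 : ℝ) • (D + D.flip - K)

/-- `Γ(u, v; w) = ½ (∂_u G(v, w) + ∂_v G(u, w) - ∂_w G(u, v))`. -/
theorem christoffelLower_apply (G : E → E →L[ℝ] E →L[ℝ] ℝ) (x u v w : E) :
    christoffelLower G x u v w =
      (1 / 2) * (fderiv ℝ G x u v w + fderiv ℝ G x v u w - fderiv ℝ G x w u v) := rfl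

/-- The Christoffel symbols `Γ(u, v)` of the Levi-Civita connection: the index `w` of
`Γ(u, v; w)` is raised with the inverse metric. -/
def christoffel (G : E → E →L[ℝ] E →L[ℝ] ℝ) (x : E) : E →L[ℝ] E →L[ℝ] E :=
  (ContinuousLinearMap.compL ℝ E (E →L[ℝ] ℝ) E (G x).inverse).comp (christoffelLower G x)

theorem christoffel_apply (G : E → E →L[ℝ] E →L[ℝ] ℝ) (x u v : E) :
    christoffel G x u v = (G x).inverse (christoffelLower G x u v) := rfl

/-- `∇_Y ∇_X Z` for constant vector fields, as a function of `Y`, `X`, `Z`. -/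
def secondDeriv (G : E → E →L[ℝ] E →L[ℝ] ℝ) (x : E) : E →L[ℝ] E →L[ℝ] E →L[ℝ] E :=
  fderiv ℝ (christoffel G) x
    + (ContinuousLinearMap.compL ℝ E E E).bilinearComp (christoffel G x) (christoffel G x)

theorem secondDeriv_apply (G : E → E →L[ℝ] E →L[ℝ] ℝ) (x Y X Z : E) :
    secondDeriv G x Y X Z =
      fderiv ℝ (christoffel G) x Y X Z + christoffel G x Y (christoffel G x X Z) := rfl

/-- The curvature tensor, with the sign convention
`R(X, Y)Z = ∇_Y ∇_X Z - ∇_X ∇_Y Z + ∇_[X,Y] Z`. -/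
def riemann (G : E → E →L[ℝ] E →L[ℝ] ℝ) (x : E) : E →L[ℝ] E →L[ℝ] E →L[ℝ] E :=
  (secondDeriv G x).flip - secondDeriv G x

theorem riemann_apply (G : E → E →L[ℝ] E →L[ℝ] ℝ) (x X Y Z : E) :
    riemann G x X Y Z = secondDeriv G x Y X Z - secondDeriv G x X Y Z := rfl

/-- The tensor `(X, Y, Z) ↦ G(X, Z) Y - G(Y, Z) X`. -/
def metricWedge (G : E → E →L[ℝ] E →L[ℝ] ℝ) (x : E) : E →L[ℝ] E →L[ℝ] E →L[ℝ] E :=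
  (ContinuousLinearMap.smulRightL ℝ E E).comp (G x)
    - ((ContinuousLinearMap.smulRightL ℝ E E).comp (G x)).flip

theorem metricWedge_apply (G : E → E →L[ℝ] E →L[ℝ] ℝ) (x X Y Z : E) :
    metricWedge G x X Y Z = G x X Z • Y - G x Y Z • X := rfl

variable [FiniteDimensional ℝ E]

/-- The Ricci tensor `Ric(X, Y) = tr (V ↦ R(X, V)Y)`. -/
def ricci (G : E → E →L[ℝ] E →L[ℝ] ℝ) (x : E) : E →L[ℝ] E →L[ℝ] ℝ :=
  (ContinuousLinearMap.compL ℝ E (E →L[ℝ] E) ℝ (traceCLM E)).comp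
    ((flipCLM E E).comp (riemann G x))

theorem ricci_apply (G : E → E →L[ℝ] E →L[ℝ] ℝ) (x X Y : E) :
    ricci G x X Y = LinearMap.trace ℝ E ((riemann G x X).flip Y : E →ₗ[ℝ] E) := rfl

/-- The scalar curvature: the trace of the Ricci tensor with respect to the metric. -/
def scalar (G : E → E →L[ℝ] E →L[ℝ] ℝ) (x : E) : ℝ :=
  traceCLM E ((G x).inverse.comp (ricci G x))

/-- The concircular curvature tensor
`C(X, Y)Z = R(X, Y)Z - τ / (n (n - 1)) (G(X, Z) Y - G(Y, Z) X)`, where `n = dim E`.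
For `n ≤ 1` the correction term and `R` both vanish. -/
def concircular (G : E → E →L[ℝ] E →L[ℝ] ℝ) (x : E) : E →L[ℝ] E →L[ℝ] E →L[ℝ] E :=
  riemann G x - (scalar G x / ((Module.finrank ℝ E : ℝ) * ((Module.finrank ℝ E : ℝ) - 1))) •
    metricWedge G x

/-- The covariant derivative `V ↦ (∇_V T)(X, Y)Z` of a tensor field `T` of type `(1,3)`. -/
def covDeriv (G : E → E →L[ℝ] E →L[ℝ] ℝ) (T : E → E →L[ℝ] E →L[ℝ] E →L[ℝ] E) (x X Y Z : E) :
    E →ₗ[ℝ] E where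
  toFun V := fderiv ℝ T x V X Y Z + christoffel G x V (T x X Y Z)
    - T x (christoffel G x V X) Y Z - T x X (christoffel G x V Y) Z
    - T x X Y (christoffel G x V Z)
  map_add' V W := by simp only [map_add, add_apply]; abel
  map_smul' c V := by
    simp only [map_smul, smul_apply, smul_sub, smul_add, RingHom.id_apply]

/-- The divergence `(div T)(X, Y, Z) = tr (V ↦ (∇_V T)(X, Y)Z)`. -/
def divergence (G : E → E →L[ℝ] E →L[ℝ] ℝ) (T : E → E →L[ℝ] E →L[ℝ] E →L[ℝ] E)
    (x X Y Z : E) : ℝ :=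
  LinearMap.trace ℝ E (covDeriv G T x X Y Z)

/-- The gradient of `F`, i.e. `G(grad F, ·) = dF`. -/
def grad (G : E → E →L[ℝ] E →L[ℝ] ℝ) (F : E → ℝ) (x : E) : E :=
  (G x).inverse (fderiv ℝ F x)

/-- The Hessian `H^F(Y, Z) = G(∇_Y grad F, Z)`. -/
def hessian (G : E → E →L[ℝ] E →L[ℝ] ℝ) (F : E → ℝ) (x Y Z : E) : ℝ :=
  G x (fderiv ℝ (grad G F) x Y + christoffel G x Y (grad G F x)) Z

end LocalGeometry

/-! ## Pseudo-Riemannian manifolds -/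

section Manifold

variable {E : Type*} [NormedAddCommGroup E] [NormedSpace ℝ E]
  {H : Type*} [TopologicalSpace H] (I : ModelWithCorners ℝ E H)
  {M : Type*} [TopologicalSpace M] [ChartedSpace H M]

/-- The coordinate expression of a covariant 2-tensor field `b` in the chart at `p`: the pullback
of `b` under the inverse of the chart. -/
def tensorInChart (b : ∀ x : M, TangentSpace I x →L[ℝ] TangentSpace I x →L[ℝ] ℝ) (p : M) (y : E) :
    E →L[ℝ] E →L[ℝ] ℝ :=
  let B : E →L[ℝ] E →L[ℝ] ℝ := b ((extChartAt I p).symm y)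
  let A : E →L[ℝ] E := mfderiv 𝓘(ℝ, E) I (extChartAt I p).symm y
  B.bilinearComp A A

theorem tensorInChart_apply
    (b : ∀ x : M, TangentSpace I x →L[ℝ] TangentSpace I x →L[ℝ] ℝ) (p : M) (y u v : E) :
    tensorInChart I b p y u v = b ((extChartAt I p).symm y)
      (mfderiv 𝓘(ℝ, E) I (extChartAt I p).symm y u)
      (mfderiv 𝓘(ℝ, E) I (extChartAt I p).symm y v) := rfl

variable (M) in
/-- A pseudo-Riemannian metric: a smooth field of symmetric nondegenerate bilinear forms on the
tangent spaces (smooth means that its coordinate expressions are smooth). -/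
structure PseudoRiemannianMetric where
  val : ∀ x : M, TangentSpace I x →L[ℝ] TangentSpace I x →L[ℝ] ℝ
  symm : ∀ (x : M) (v w : TangentSpace I x), val x v w = val x w v
  nondegenerate : ∀ (x : M) (v : TangentSpace I x), (∀ w : TangentSpace I x, val x v w = 0) → v = 0
  smooth : ∀ p : M, ContDiffOn ℝ ∞ (tensorInChart I val p) (extChartAt I p).target

end Manifold

namespace PseudoRiemannianMetric

variable {E : Type*} [NormedAddCommGroup E] [NormedSpace ℝ E]
  {H : Type*} [TopologicalSpace H] {I : ModelWithCorners ℝ E H}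
  {M : Type*} [TopologicalSpace M] [ChartedSpace H M]

/-- The coordinate expression of the metric in the chart at `p`. -/
def inChart (g : PseudoRiemannianMetric I M) (p : M) : E → E →L[ℝ] E →L[ℝ] ℝ :=
  tensorInChart I g.val p

/-- In Mathlib `TangentSpace I p` is the model space `E`, a vector being identified with its
coordinates in the chart at `p`.  In these coordinates the metric at `p` is the metric at `p`. -/
theorem inChart_self [I.Boundaryless] [IsManifold I ∞ M] (g : PseudoRiemannianMetric I M) (p : M)
    (u v : E) : g.inChart p (extChartAt I p p) u v =
      g.val p (u : TangentSpace I p) (v : TangentSpace I p) := by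
  have key : ∀ (q : M), q = p → ∀ L : E →L[ℝ] E,
      L = fderivWithin ℝ (extChartAt I q ∘ (extChartAt I p).symm) (range I) (extChartAt I p p) →
      g.val q (L u : TangentSpace I q) (L v : TangentSpace I q) =
        g.val p (u : TangentSpace I p) (v : TangentSpace I p) := by
    rintro q rfl L hL
    have h : ∀ w, L w = w := fun w => by
      rw [hL]
      exact tangentCoordChange_self (I := I) (x := q) (z := q) (v := w) (mem_extChartAt_source q)
    rw [h u, h v]
  have hd : MDifferentiableAt 𝓘(ℝ, E) I (extChartAt I p).symm (extChartAt I p p) :=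
    ((contMDiffOn_extChartAt_symm (I := I) (n := ∞) p).contMDiffAt
      (extChartAt_target_mem_nhds p)).mdifferentiableAt (by simp)
  refine key _ (extChartAt_to_inv p) _ ?_
  rw [I.range_eq_univ]
  refine hd.mfderiv.trans ?_
  rw [modelWithCornersSelf_coe, range_id]
  rfl

/-! The tensors of the metric at `p`, all computed in the chart at `p`.  They are tensors, so that
another chart around `p` yields the same objects on `TangentSpace I p`. -/

variable [FiniteDimensional ℝ E]

/-- The curvature tensor `R(X, Y)Z` at `p`. -/
def riemann (g : PseudoRiemannianMetric I M) (p : M) (X Y Z : TangentSpace I p) :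
    TangentSpace I p :=
  LocalGeometry.riemann (E := E) (g.inChart p) (extChartAt I p p) X Y Z

/-- The Ricci tensor at `p`. -/
def ricci (g : PseudoRiemannianMetric I M) (p : M) (X Y : TangentSpace I p) : ℝ :=
  LocalGeometry.ricci (E := E) (g.inChart p) (extChartAt I p p) X Y

/-- The gradient of `f` at `p`. -/
def grad (g : PseudoRiemannianMetric I M) (f : M → ℝ) (p : M) : TangentSpace I p :=
  LocalGeometry.grad (E := E) (g.inChart p) (f ∘ (extChartAt I p).symm) (extChartAt I p p)

/-- The Hessian `H^f(Y, Z) = g(∇_Y grad f, Z)` at `p`. -/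
def hessian (g : PseudoRiemannianMetric I M) (f : M → ℝ) (p : M) (Y Z : TangentSpace I p) : ℝ :=
  LocalGeometry.hessian (E := E) (g.inChart p) (f ∘ (extChartAt I p).symm) (extChartAt I p p) Y Z

/-- The divergence of the concircular curvature tensor at `p`. -/
def divConcircular (g : PseudoRiemannianMetric I M) (p : M) (X Y Z : TangentSpace I p) : ℝ :=
  LocalGeometry.divergence (E := E) (g.inChart p) (LocalGeometry.concircular (g.inChart p))
    (extChartAt I p p) X Y Z

/-- The concircular curvature tensor is divergence free. -/
def ConcircularDivergenceFree (g : PseudoRiemannianMetric I M) : Prop :=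
  ∀ (p : M) (X Y Z : TangentSpace I p), g.divConcircular p X Y Z = 0

/-- The metric is Einstein: `Ric = c g` for a constant `c`. -/
def IsEinstein (g : PseudoRiemannianMetric I M) : Prop :=
  ∃ c : ℝ, ∀ (p : M) (X Y : TangentSpace I p), g.ricci p X Y = c * g.val p X Y

end PseudoRiemannianMetric

/-- The derivative `X(f)` of a function in the direction of a tangent vector. -/
def dirDeriv {E : Type*} [NormedAddCommGroup E] [NormedSpace ℝ E]
    {H : Type*} [TopologicalSpace H] (I : ModelWithCorners ℝ E H)
    {M : Type*} [TopologicalSpace M] [ChartedSpace H M]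
    (f : M → ℝ) (p : M) (X : TangentSpace I p) : ℝ :=
  mfderiv I 𝓘(ℝ, ℝ) f p X

/-! ## Warped products -/

section Warped

variable {E₁ : Type*} [NormedAddCommGroup E₁] [NormedSpace ℝ E₁]
  {H₁ : Type*} [TopologicalSpace H₁] {I₁ : ModelWithCorners ℝ E₁ H₁}
  {M₁ : Type*} [TopologicalSpace M₁] [ChartedSpace H₁ M₁]
  {E₂ : Type*} [NormedAddCommGroup E₂] [NormedSpace ℝ E₂]
  {H₂ : Type*} [TopologicalSpace H₂] {I₂ : ModelWithCorners ℝ E₂ H₂}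
  {M₂ : Type*} [TopologicalSpace M₂] [ChartedSpace H₂ M₂]

/-- The tensor field `π₁^* g₁ + (f ∘ π₁)² π₂^* g₂` on `M₁ × M₂`. -/
def warpedTensor (g₁ : PseudoRiemannianMetric I₁ M₁) (g₂ : PseudoRiemannianMetric I₂ M₂)
    (f : M₁ → ℝ) (z : M₁ × M₂) :
    TangentSpace (I₁.prod I₂) z →L[ℝ] TangentSpace (I₁.prod I₂) z →L[ℝ] ℝ :=
  let B₁ : E₁ →L[ℝ] E₁ →L[ℝ] ℝ := g₁.val z.1
  let B₂ : E₂ →L[ℝ] E₂ →L[ℝ] ℝ := g₂.val z.2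
  let A₁ : E₁ × E₂ →L[ℝ] E₁ := mfderiv (I₁.prod I₂) I₁ (Prod.fst : M₁ × M₂ → M₁) z
  let A₂ : E₁ × E₂ →L[ℝ] E₂ := mfderiv (I₁.prod I₂) I₂ (Prod.snd : M₁ × M₂ → M₂) z
  (B₁.bilinearComp A₁ A₁ + (f z.1) ^ 2 • B₂.bilinearComp A₂ A₂ : E₁ × E₂ →L[ℝ] E₁ × E₂ →L[ℝ] ℝ)

theorem warpedTensor_apply (g₁ : PseudoRiemannianMetric I₁ M₁) (g₂ : PseudoRiemannianMetric I₂ M₂)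
    (f : M₁ → ℝ) (z : M₁ × M₂) (u v : TangentSpace (I₁.prod I₂) z) :
    warpedTensor g₁ g₂ f z u v =
      g₁.val z.1 (u : E₁ × E₂).1 (v : E₁ × E₂).1
        + (f z.1) ^ 2 * g₂.val z.2 (u : E₁ × E₂).2 (v : E₁ × E₂).2 := by
  have h1 : (mfderiv (I₁.prod I₂) I₁ (Prod.fst : M₁ × M₂ → M₁) z : E₁ × E₂ → E₁) = Prod.fst := by
    rw [mfderiv_fst]; rfl
  have h2 : (mfderiv (I₁.prod I₂) I₂ (Prod.snd : M₁ × M₂ → M₂) z : E₁ × E₂ → E₂) = Prod.snd := by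
    rw [mfderiv_snd]; rfl
  have h3 : warpedTensor g₁ g₂ f z u v =
      g₁.val z.1 ((mfderiv (I₁.prod I₂) I₁ (Prod.fst : M₁ × M₂ → M₁) z : E₁ × E₂ → E₁) u)
        ((mfderiv (I₁.prod I₂) I₁ (Prod.fst : M₁ × M₂ → M₁) z : E₁ × E₂ → E₁) v)
      + (f z.1) ^ 2 *
        g₂.val z.2 ((mfderiv (I₁.prod I₂) I₂ (Prod.snd : M₁ × M₂ → M₂) z : E₁ × E₂ → E₂) u)
        ((mfderiv (I₁.prod I₂) I₂ (Prod.snd : M₁ × M₂ → M₂) z : E₁ × E₂ → E₂) v) := rfl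
  rw [h3, h1, h2]

variable [I₁.Boundaryless] [I₂.Boundaryless] [IsManifold I₁ ∞ M₁] [IsManifold I₂ ∞ M₂]

/-- In a product chart, the warped product tensor is `G₁ + F² G₂`. -/
theorem tensorInChart_warpedTensor (g₁ : PseudoRiemannianMetric I₁ M₁)
    (g₂ : PseudoRiemannianMetric I₂ M₂) (f : M₁ → ℝ) (p : M₁ × M₂) (y : E₁ × E₂)
    (h1 : y.1 ∈ (extChartAt I₁ p.1).target) (h2 : y.2 ∈ (extChartAt I₂ p.2).target) :
    tensorInChart (I₁.prod I₂) (warpedTensor g₁ g₂ f) p y =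
      (g₁.inChart p.1 y.1).bilinearComp (ContinuousLinearMap.fst ℝ E₁ E₂)
        (ContinuousLinearMap.fst ℝ E₁ E₂)
      + (f ((extChartAt I₁ p.1).symm y.1)) ^ 2 •
        (g₂.inChart p.2 y.2).bilinearComp (ContinuousLinearMap.snd ℝ E₁ E₂)
          (ContinuousLinearMap.snd ℝ E₁ E₂) := by
  have d1 : MDifferentiableAt 𝓘(ℝ, E₁) I₁ (extChartAt I₁ p.1).symm y.1 :=
    ((contMDiffOn_extChartAt_symm (I := I₁) (n := ∞) p.1).contMDiffAt
      ((isOpen_extChartAt_target p.1).mem_nhds h1)).mdifferentiableAt (by simp)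
  have d2 : MDifferentiableAt 𝓘(ℝ, E₂) I₂ (extChartAt I₂ p.2).symm y.2 :=
    ((contMDiffOn_extChartAt_symm (I := I₂) (n := ∞) p.2).contMDiffAt
      ((isOpen_extChartAt_target p.2).mem_nhds h2)).mdifferentiableAt (by simp)
  have hm : ∀ u : E₁ × E₂, mfderiv 𝓘(ℝ, E₁ × E₂) (I₁.prod I₂)
      (extChartAt (I₁.prod I₂) p).symm y u =
      ((mfderiv 𝓘(ℝ, E₁) I₁ (extChartAt I₁ p.1).symm y.1 u.1,
        mfderiv 𝓘(ℝ, E₂) I₂ (extChartAt I₂ p.2).symm y.2 u.2) : E₁ × E₂) := fun u => by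
    have e1 : HasMFDerivAt 𝓘(ℝ, E₁ × E₂) I₁ (fun w : E₁ × E₂ => (extChartAt I₁ p.1).symm w.1) y _ :=
      HasMFDerivAt.comp (I' := 𝓘(ℝ, E₁)) y d1.hasMFDerivAt
        (ContinuousLinearMap.fst ℝ E₁ E₂).hasMFDerivAt
    have e2 : HasMFDerivAt 𝓘(ℝ, E₁ × E₂) I₂ (fun w : E₁ × E₂ => (extChartAt I₂ p.2).symm w.2) y _ :=
      HasMFDerivAt.comp (I' := 𝓘(ℝ, E₂)) y d2.hasMFDerivAt
        (ContinuousLinearMap.snd ℝ E₁ E₂).hasMFDerivAt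
    have e := (e1.prodMk e2).mfderiv
    have e' := congrArg (fun L : E₁ × E₂ →L[ℝ] E₁ × E₂ => L u) e
    rw [extChartAt_prod]
    exact e'
  refine ContinuousLinearMap.ext fun u => ContinuousLinearMap.ext fun v => ?_
  rw [tensorInChart_apply, hm u, hm v]
  exact warpedTensor_apply g₁ g₂ f _ _ _

theorem contDiff_pull {E F : Type*} [NormedAddCommGroup E] [NormedSpace ℝ E]
    [NormedAddCommGroup F] [NormedSpace ℝ F] (A : E →L[ℝ] F) {s : Set E}
    {G : E → F →L[ℝ] F →L[ℝ] ℝ} (hG : ContDiffOn ℝ ∞ G s) :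
    ContDiffOn ℝ ∞ (fun x => (G x).bilinearComp A A) s := by
  have h : (fun x => (G x).bilinearComp A A) =
      fun x => ((ContinuousLinearMap.compL ℝ E F ℝ).flip A).comp ((G x).comp A) := rfl
  rw [h]
  exact contDiffOn_const.clm_comp (hG.clm_comp contDiffOn_const)

/-- The metric of the warped product `M₁ ×_f M₂`. -/
def PseudoRiemannianMetric.warpedProduct (g₁ : PseudoRiemannianMetric I₁ M₁)
    (g₂ : PseudoRiemannianMetric I₂ M₂) (f : M₁ → ℝ) (hf : ContMDiff I₁ 𝓘(ℝ, ℝ) ∞ f)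
    (hpos : ∀ p, 0 < f p) : PseudoRiemannianMetric (I₁.prod I₂) (M₁ × M₂) where
  val := warpedTensor g₁ g₂ f
  symm z v w := by
    rw [warpedTensor_apply, warpedTensor_apply]
    exact congrArg₂ (fun a b : ℝ => a + (f z.1) ^ 2 * b)
      (g₁.symm z.1 (v : E₁ × E₂).1 (w : E₁ × E₂).1) (g₂.symm z.2 (v : E₁ × E₂).2 (w : E₁ × E₂).2)
  nondegenerate z v hv := by
    refine Prod.ext (g₁.nondegenerate z.1 _ fun w => ?_) (g₂.nondegenerate z.2 _ fun w => ?_)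
    · have h := hv (show TangentSpace (I₁.prod I₂) z from ((w, 0) : E₁ × E₂))
      rw [warpedTensor_apply] at h
      have h0 : g₂.val z.2 (show TangentSpace I₂ z.2 from (v : E₁ × E₂).2)
          (show TangentSpace I₂ z.2 from (0 : E₂)) = 0 := map_zero _
      rw [h0, mul_zero, add_zero] at h
      exact h
    · have h := hv (show TangentSpace (I₁.prod I₂) z from ((0, w) : E₁ × E₂))
      rw [warpedTensor_apply] at h
      have h0 : g₁.val z.1 (show TangentSpace I₁ z.1 from (v : E₁ × E₂).1)
          (show TangentSpace I₁ z.1 from (0 : E₁)) = 0 := map_zero _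
      rw [h0, zero_add] at h
      exact (mul_eq_zero.mp h).resolve_left (pow_ne_zero 2 (hpos z.1).ne')
  smooth p := by
    have hF : ContDiffOn ℝ ∞ (f ∘ (extChartAt I₁ p.1).symm) (extChartAt I₁ p.1).target :=
      (hf.comp_contMDiffOn (contMDiffOn_extChartAt_symm p.1)).contDiffOn
    have h1 : MapsTo (Prod.fst : E₁ × E₂ → E₁) (extChartAt (I₁.prod I₂) p).target
        (extChartAt I₁ p.1).target := fun y hy => by
      rw [extChartAt_prod] at hy; exact hy.1
    have h2 : MapsTo (Prod.snd : E₁ × E₂ → E₂) (extChartAt (I₁.prod I₂) p).target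
        (extChartAt I₂ p.2).target := fun y hy => by
      rw [extChartAt_prod] at hy; exact hy.2
    have hG1 := contDiff_pull (ContinuousLinearMap.fst ℝ E₁ E₂)
      ((g₁.smooth p.1).comp contDiff_fst.contDiffOn h1)
    have hG2 := contDiff_pull (ContinuousLinearMap.snd ℝ E₁ E₂)
      ((g₂.smooth p.2).comp contDiff_snd.contDiffOn h2)
    refine (hG1.add (((hF.comp contDiff_fst.contDiffOn h1).pow 2).smul hG2)).congr ?_
    intro y hy
    exact tensorInChart_warpedTensor g₁ g₂ f p y (h1 hy) (h2 hy)

end Warped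

end

/-! The divergence condition on the concircular tensor is a condition on the Ricci tensor alone. The
second Bianchi identity gives div R = -d^∇Ric, where d^∇Ric(X,Y,Z) = (∇_X Ric)(Y,Z) - (∇_Y Ric)(X,Z)
is `codazziDefect`. The correction term of C is a multiple of τ times a parallel tensor, so it only
contributes dτ (`divergence_concircular`). Tracing div C = 0 and using the contracted Bianchi
identity yields dτ/2 = dτ/m. Hence dτ = 0 for m ≥ 3, and Ric is a Codazzi tensor
(`codazziDefect_ricci_eq_zero`). Conversely, a Codazzi Ricci tensor forces dτ = 0 and div C = 0 in
every dimension (`divergence_concircular_eq_zero`), so the factors may have small dimension.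

The Ricci tensor of the warped product is block diagonal: Ric¹ - n₂ F on the base and Ric² - (fΔf +
(n₂ - 1)|grad f|²) g₂ on the fibre (`ricci_eq`). Its Codazzi equation is read off in three types of
directions. Base: d^∇Ric¹ = n₂ d^∇F. By the Ricci identity, d^∇F is the expression whose vanishing
is the curvature hypothesis of part 1 (`codazziDefect_hessianRatio`). Fibre: d^∇Ric² = 0, which is
part 2. Mixed: X(log f) Ric² equals g₂ times a quantity depending only on the base point
(`codazziDefect_mixed`). At a base point with df ≠ 0 this is the Einstein equation; if there is no
such point, f is constant because M₁ is connected.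

All tensor identities are proved in charts with constant vector fields, each by differentiating a
pointwise identity along a line. -/

noncomputable section

/-! ## Derivatives along lines -/

section Line

variable {E F K : Type*} [NormedAddCommGroup E] [NormedSpace ℝ E]
  [NormedAddCommGroup F] [NormedSpace ℝ F] [NormedAddCommGroup K] [NormedSpace ℝ K]

/-- This reduces Fréchet derivatives to derivatives in one real variable. An identity valid near x
is differentiated by computing both sides along t ↦ x + tV and invoking uniqueness of the
derivative. -/
theorem DifferentiableAt.hasDerivAt_line {T : E → F} {x : E} (hT : DifferentiableAt ℝ T x) (V : E) :
    HasDerivAt (fun t : ℝ => T (x + t • V)) (fderiv ℝ T x V) 0 := by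
  have h1 : HasDerivAt (fun t : ℝ => x + t • V) V 0 := by
    simpa using ((hasDerivAt_id (0 : ℝ)).smul_const V).const_add x
  have h2 : HasFDerivAt T (fderiv ℝ T x) (x + (0 : ℝ) • V) := by simpa using hT.hasFDerivAt
  exact h2.comp_hasDerivAt 0 h1

theorem eventually_line {U : Set E} {x : E} (hU : U ∈ 𝓝 x) (V : E) :
    ∀ᶠ t : ℝ in 𝓝 0, x + t • V ∈ U := by
  have h : ContinuousAt (fun t : ℝ => x + t • V) 0 := by fun_prop
  exact h (by simpa using hU)

theorem HasDerivAt.apply_const {c : ℝ → E →L[ℝ] F} {c' : E →L[ℝ] F} {t : ℝ}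
    (h : HasDerivAt c c' t) (v : E) : HasDerivAt (fun s => c s v) (c' v) t := by
  simpa using h.clm_apply (hasDerivAt_const t v)

end Line

/-! ### Levi-Civita connection, curvature symmetries and the second Bianchi identity in coordinates
-/

namespace LocalGeometry

variable {E : Type*} [NormedAddCommGroup E] [NormedSpace ℝ E]

/-- `G` is a smooth field of symmetric nondegenerate bilinear forms on the open set `U`. -/
structure IsMetricOn (G : E → E →L[ℝ] E →L[ℝ] ℝ) (U : Set E) : Prop where
  isOpen : IsOpen U
  contDiffOn : ContDiffOn ℝ ∞ G U
  symm : ∀ x ∈ U, ∀ u v, G x u v = G x v u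
  nondegenerate : ∀ x ∈ U, ∀ u, (∀ v, G x u v = 0) → u = 0

namespace IsMetricOn

variable {G : E → E →L[ℝ] E →L[ℝ] ℝ} {U : Set E} {x : E}

theorem mem_nhds (h : IsMetricOn G U) (hx : x ∈ U) : U ∈ 𝓝 x := h.isOpen.mem_nhds hx

theorem differentiableAt (h : IsMetricOn G U) (hx : x ∈ U) : DifferentiableAt ℝ G x :=
  (h.contDiffOn.contDiffAt (h.mem_nhds hx)).differentiableAt (by simp)

theorem contDiffOn_fderiv (h : IsMetricOn G U) : ContDiffOn ℝ ∞ (fderiv ℝ G) U :=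
  h.contDiffOn.fderiv_of_isOpen h.isOpen (by simp)

theorem fderiv_symm (h : IsMetricOn G U) (hx : x ∈ U) (V u v : E) :
    fderiv ℝ G x V u v = fderiv ℝ G x V v u := by
  have h1 := (((h.differentiableAt hx).hasDerivAt_line V).apply_const u).apply_const v
  have h2 := (((h.differentiableAt hx).hasDerivAt_line V).apply_const v).apply_const u
  refine h1.unique (h2.congr_of_eventuallyEq ?_)
  filter_upwards [eventually_line (h.mem_nhds hx) V] with t ht using h.symm _ ht _ _

theorem contDiffOn_christoffelLower (h : IsMetricOn G U) :
    ContDiffOn ℝ ∞ (christoffelLower G) U := by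
  have h1 := h.contDiffOn_fderiv
  have h2 : ContDiffOn ℝ ∞ (fun x => (fderiv ℝ G x).flip) U :=
    (flipCLM E (E →L[ℝ] ℝ)).contDiff.comp_contDiffOn h1
  have h3 : ContDiffOn ℝ ∞ (fun x => (flipCLM E ℝ).comp (fderiv ℝ G x).flip) U :=
    contDiffOn_const.clm_comp h2
  exact ((h1.add h2).sub h3).const_smul (1 / 2 : ℝ)

theorem ext_left (h : IsMetricOn G U) (hx : x ∈ U) {u w : E} (huw : ∀ v, G x u v = G x w v) :
    u = w := by
  refine sub_eq_zero.1 (h.nondegenerate x hx _ fun v => ?_)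
  rw [map_sub, sub_apply, huw, sub_self]

theorem christoffel_symm (h : IsMetricOn G U) (hx : x ∈ U) (u v : E) :
    christoffel G x u v = christoffel G x v u := by
  rw [christoffel_apply, christoffel_apply]
  congr 1
  ext w
  rw [christoffelLower_apply, christoffelLower_apply, h.fderiv_symm hx w u v]
  ring

theorem riemann_antisymm (G : E → E →L[ℝ] E →L[ℝ] ℝ) (x X Y : E) :
    riemann G x X Y = -riemann G x Y X := by
  ext Z
  simp [riemann_apply]

theorem snd_fderiv_symm (h : IsMetricOn G U) (hx : x ∈ U) (V W : E) :
    fderiv ℝ (fderiv ℝ G) x V W = fderiv ℝ (fderiv ℝ G) x W V :=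
  (h.contDiffOn.contDiffAt (h.mem_nhds hx)).isSymmSndFDerivAt
    (by simpa using WithTop.coe_le_coe.2 (le_top : (2 : ℕ∞) ≤ ⊤)) V W

variable [FiniteDimensional ℝ E]

/-- `ContinuousLinearMap.inverse` is zero on maps that are not invertible, so every raised index
depends on this fact. Nondegeneracy is injectivity, and E and its dual have equal dimension. -/
theorem isInvertible (h : IsMetricOn G U) (hx : x ∈ U) : (G x).IsInvertible := by
  have hinj : Function.Injective (G x : E →ₗ[ℝ] E →L[ℝ] ℝ) := by
    refine (injective_iff_map_eq_zero _).2 fun u hu => h.nondegenerate x hx u fun v => ?_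
    exact congrArg (fun L : E →L[ℝ] ℝ => L v) hu
  have hdim : Module.finrank ℝ E = Module.finrank ℝ (E →L[ℝ] ℝ) := by
    rw [← (LinearMap.toContinuousLinearMap : (E →ₗ[ℝ] ℝ) ≃ₗ[ℝ] (E →L[ℝ] ℝ)).finrank_eq]
    exact (Subspace.dual_finrank_eq (K := ℝ) (V := E)).symm
  refine ⟨(LinearEquiv.ofInjectiveOfFinrankEq (G x : E →ₗ[ℝ] E →L[ℝ] ℝ)
    hinj hdim).toContinuousLinearEquiv, ?_⟩
  ext u v
  rfl

theorem apply_inverse (h : IsMetricOn G U) (hx : x ∈ U) (α : E →L[ℝ] ℝ) :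
    G x ((G x).inverse α) = α := by
  obtain ⟨e, he⟩ := h.isInvertible hx
  rw [← he, ContinuousLinearMap.inverse_equiv]
  exact e.apply_symm_apply α

theorem apply_inverse_apply (h : IsMetricOn G U) (hx : x ∈ U) (α : E →L[ℝ] ℝ) (v : E) :
    G x ((G x).inverse α) v = α v := by rw [h.apply_inverse hx]

theorem contDiffOn_inverse (h : IsMetricOn G U) : ContDiffOn ℝ ∞ (fun x => (G x).inverse) U :=
  fun x hx => ((h.isInvertible hx).contDiffAt_map_inverse.comp_contDiffWithinAt x
    (h.contDiffOn x hx))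

theorem contDiffOn_christoffel (h : IsMetricOn G U) : ContDiffOn ℝ ∞ (christoffel G) U := by
  have h1 : ContDiffOn ℝ ∞
      (fun x => ContinuousLinearMap.compL ℝ E (E →L[ℝ] ℝ) E (G x).inverse) U :=
    (ContinuousLinearMap.compL ℝ E (E →L[ℝ] ℝ) E).contDiff.comp_contDiffOn h.contDiffOn_inverse
  exact h1.clm_comp h.contDiffOn_christoffelLower

theorem contDiffOn_fderiv_christoffel (h : IsMetricOn G U) :
    ContDiffOn ℝ ∞ (fderiv ℝ (christoffel G)) U :=
  h.contDiffOn_christoffel.fderiv_of_isOpen h.isOpen (by simp)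

theorem differentiableAt_christoffel (h : IsMetricOn G U) (hx : x ∈ U) :
    DifferentiableAt ℝ (christoffel G) x :=
  (h.contDiffOn_christoffel.contDiffAt (h.mem_nhds hx)).differentiableAt (by simp)

theorem differentiableAt_fderiv_christoffel (h : IsMetricOn G U) (hx : x ∈ U) :
    DifferentiableAt ℝ (fderiv ℝ (christoffel G)) x :=
  (h.contDiffOn_fderiv_christoffel.contDiffAt (h.mem_nhds hx)).differentiableAt (by simp)

theorem contDiffOn_secondDeriv (h : IsMetricOn G U) : ContDiffOn ℝ ∞ (secondDeriv G) U := by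
  refine h.contDiffOn_fderiv_christoffel.add ?_
  -- `bilinearComp` unfolds to compose, flip, compose, flip; smoothness is carried through these
  -- four operations.
  have h1 : ContDiffOn ℝ ∞
      (fun x => (ContinuousLinearMap.compL ℝ E E E).comp (christoffel G x)) U :=
    contDiffOn_const.clm_comp h.contDiffOn_christoffel
  have h2 : ContDiffOn ℝ ∞
      (fun x => ((ContinuousLinearMap.compL ℝ E E E).comp (christoffel G x)).flip) U :=
    (ContinuousLinearMap.flipₗᵢ ℝ E (E →L[ℝ] E) (E →L[ℝ] E)).contDiff.comp_contDiffOn h1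
  have h3 := h2.clm_comp h.contDiffOn_christoffel
  exact (ContinuousLinearMap.flipₗᵢ ℝ E E (E →L[ℝ] E)).contDiff.comp_contDiffOn h3

theorem contDiffOn_riemann (h : IsMetricOn G U) : ContDiffOn ℝ ∞ (riemann G) U :=
  ((ContinuousLinearMap.flipₗᵢ ℝ E E (E →L[ℝ] E)).contDiff.comp_contDiffOn
    h.contDiffOn_secondDeriv).sub h.contDiffOn_secondDeriv

theorem contDiffOn_ricci (h : IsMetricOn G U) : ContDiffOn ℝ ∞ (ricci G) U :=
  contDiffOn_const.clm_comp (contDiffOn_const.clm_comp h.contDiffOn_riemann)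

theorem contDiffOn_scalar (h : IsMetricOn G U) : ContDiffOn ℝ ∞ (scalar G) U :=
  (traceCLM E).contDiff.comp_contDiffOn (h.contDiffOn_inverse.clm_comp h.contDiffOn_ricci)

theorem differentiableAt_riemann (h : IsMetricOn G U) (hx : x ∈ U) :
    DifferentiableAt ℝ (riemann G) x :=
  (h.contDiffOn_riemann.contDiffAt (h.mem_nhds hx)).differentiableAt (by simp)

theorem differentiableAt_ricci (h : IsMetricOn G U) (hx : x ∈ U) :
    DifferentiableAt ℝ (ricci G) x :=
  (h.contDiffOn_ricci.contDiffAt (h.mem_nhds hx)).differentiableAt (by simp)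

theorem differentiableAt_scalar (h : IsMetricOn G U) (hx : x ∈ U) :
    DifferentiableAt ℝ (scalar G) x :=
  (h.contDiffOn_scalar.contDiffAt (h.mem_nhds hx)).differentiableAt (by simp)

/-- The Levi-Civita connection is metric. -/
theorem fderiv_eq (h : IsMetricOn G U) (hx : x ∈ U) (V u v : E) :
    fderiv ℝ G x V u v = G x (christoffel G x V u) v + G x u (christoffel G x V v) := by
  rw [h.symm x hx u, christoffel_apply, christoffel_apply, h.apply_inverse_apply hx,
    h.apply_inverse_apply hx, christoffelLower_apply, christoffelLower_apply,
    h.fderiv_symm hx V v u]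
  ring

theorem snd_fderiv_christoffel_symm (h : IsMetricOn G U) (hx : x ∈ U) (V W : E) :
    fderiv ℝ (fderiv ℝ (christoffel G)) x V W = fderiv ℝ (fderiv ℝ (christoffel G)) x W V :=
  (h.contDiffOn_christoffel.contDiffAt (h.mem_nhds hx)).isSymmSndFDerivAt
    (by simpa using WithTop.coe_le_coe.2 (le_top : (2 : ℕ∞) ≤ ⊤)) V W

/-- Metric compatibility `fderiv_eq`, differentiated once more in direction Y. The last two terms
together are symmetric in X and Y, so antisymmetrizing leaves only curvature. -/
theorem snd_fderiv_eq (h : IsMetricOn G U) (hx : x ∈ U) (Y X u v : E) :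
    fderiv ℝ (fderiv ℝ G) x Y X u v =
      G x (secondDeriv G x Y X u) v + G x u (secondDeriv G x Y X v)
        + G x (christoffel G x X u) (christoffel G x Y v)
        + G x (christoffel G x Y u) (christoffel G x X v) := by
  have hD : DifferentiableAt ℝ (fderiv ℝ G) x :=
    (h.contDiffOn_fderiv.contDiffAt (h.mem_nhds hx)).differentiableAt (by simp)
  have h1 := (((hD.hasDerivAt_line Y).apply_const X).apply_const u).apply_const v
  have hG := (h.differentiableAt hx).hasDerivAt_line Y
  have hΓ := ((h.differentiableAt_christoffel hx).hasDerivAt_line Y).apply_const X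
  have h2 := ((hG.clm_apply (hΓ.apply_const u)).apply_const v).add
    ((hG.apply_const u).clm_apply (hΓ.apply_const v))
  rw [h1.unique (h2.congr_of_eventuallyEq ?_)]
  · simp only [zero_smul, add_zero, add_apply, h.fderiv_eq hx, secondDeriv_apply, map_add]
    ring
  · filter_upwards [eventually_line (h.mem_nhds hx) Y] with t ht using h.fderiv_eq ht _ _ _

/-- The curvature operators are skew with respect to the metric. -/
theorem riemann_skew (h : IsMetricOn G U) (hx : x ∈ U) (X Y u v : E) :
    G x (riemann G x X Y u) v = -G x u (riemann G x X Y v) := by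
  have h1 := h.snd_fderiv_eq hx Y X u v
  have h2 := h.snd_fderiv_eq hx X Y u v
  rw [h.snd_fderiv_symm hx Y X] at h1
  simp only [riemann_apply, map_sub, sub_apply]
  linarith

/-- The metric is parallel, so skewness of the curvature operators survives covariant
differentiation. The Christoffel corrections are absorbed by skewness itself, in `a1` to `a4`. -/
theorem covDeriv_riemann_skew (h : IsMetricOn G U) (hx : x ∈ U) (V X Y u v : E) :
    G x (covDeriv G (riemann G) x X Y u V) v = -G x u (covDeriv G (riemann G) x X Y v V) := by
  have hG := (h.differentiableAt hx).hasDerivAt_line V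
  have hR := (((h.differentiableAt_riemann hx).hasDerivAt_line V).apply_const X).apply_const Y
  have h1 := (hG.clm_apply (hR.apply_const u)).apply_const v
  have h2 := ((hG.apply_const u).clm_apply (hR.apply_const v)).neg
  have h3 := h1.unique (h2.congr_of_eventuallyEq (by
    filter_upwards [eventually_line (h.mem_nhds hx) V] with t ht using h.riemann_skew ht _ _ _ _))
  simp only [zero_smul, add_zero, add_apply, h.fderiv_eq hx] at h3
  simp only [covDeriv, LinearMap.coe_mk, AddHom.coe_mk, map_add, map_sub, sub_apply,
    add_apply]
  have a1 := h.riemann_skew hx X Y u (christoffel G x V v)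
  have a2 := h.riemann_skew hx X Y (christoffel G x V u) v
  have a3 := h.riemann_skew hx (christoffel G x V X) Y u v
  have a4 := h.riemann_skew hx X (christoffel G x V Y) u v
  linarith

theorem fderiv_riemann (h : IsMetricOn G U) (hx : x ∈ U) (V X Y Z : E) :
    fderiv ℝ (riemann G) x V X Y Z =
      (fderiv ℝ (fderiv ℝ (christoffel G)) x V Y X Z
        + (fderiv ℝ (christoffel G) x V Y (christoffel G x X Z)
          + christoffel G x Y (fderiv ℝ (christoffel G) x V X Z)))
      - (fderiv ℝ (fderiv ℝ (christoffel G)) x V X Y Z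
        + (fderiv ℝ (christoffel G) x V X (christoffel G x Y Z)
          + christoffel G x X (fderiv ℝ (christoffel G) x V Y Z))) := by
  have hR := ((((h.differentiableAt_riemann hx).hasDerivAt_line V).apply_const X).apply_const
    Y).apply_const Z
  have hΓ := (h.differentiableAt_christoffel hx).hasDerivAt_line V
  have hD := (h.differentiableAt_fderiv_christoffel hx).hasDerivAt_line V
  have hS : ∀ X Y : E, _ := fun X Y => (((hD.apply_const Y).apply_const X).apply_const Z).add
    ((hΓ.apply_const Y).clm_apply ((hΓ.apply_const X).apply_const Z))
  have h2 := hR.unique ((hS X Y).sub (hS Y X))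
  simpa only [zero_smul, add_zero] using h2

/-- The second Bianchi identity. -/
theorem second_bianchi (h : IsMetricOn G U) (hx : x ∈ U) (V X Y Z : E) :
    covDeriv G (riemann G) x X Y Z V + covDeriv G (riemann G) x Y V Z X
      + covDeriv G (riemann G) x V X Z Y = 0 := by
  simp only [covDeriv, LinearMap.coe_mk, AddHom.coe_mk, h.fderiv_riemann hx, riemann_apply,
    secondDeriv_apply]
  -- Once second derivatives of Γ and the arguments of Γ are put in a common order, the cyclic sum
  -- cancels term by term.
  rw [h.snd_fderiv_christoffel_symm hx V X, h.snd_fderiv_christoffel_symm hx V Y,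
    h.snd_fderiv_christoffel_symm hx X Y, h.christoffel_symm hx V X, h.christoffel_symm hx V Y,
    h.christoffel_symm hx X Y]
  simp only [map_add, map_sub]
  abel

end IsMetricOn

end LocalGeometry

/-! ### Traces of the Bianchi identity and the divergence of the concircular tensor -/

namespace LocalGeometry

variable {E : Type*} [NormedAddCommGroup E] [NormedSpace ℝ E]

/-- The covariant derivative `(∇_V B)(X, Y)` of a field of bilinear forms. -/
def covDerivForm (G B : E → E →L[ℝ] E →L[ℝ] ℝ) (x V X Y : E) : ℝ :=
  fderiv ℝ B x V X Y - B x (christoffel G x V X) Y - B x X (christoffel G x V Y)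

/-- The difference `(∇_X B)(Y, Z) - (∇_Y B)(X, Z)`, which vanishes if `B` is a Codazzi tensor
(see `IsMetricOn.codazziDefect_eq`). -/
def codazziDefect (G B : E → E →L[ℝ] E →L[ℝ] ℝ) (x X Y Z : E) : ℝ :=
  fderiv ℝ B x X Y Z - fderiv ℝ B x Y X Z - B x Y (christoffel G x X Z)
    + B x X (christoffel G x Y Z)

theorem trace_eq_sum_coord {ι : Type*} [Fintype ι] (e : Module.Basis ι ℝ E) (T : E →ₗ[ℝ] E) :
    LinearMap.trace ℝ E T = ∑ i, e.coord i (T (e i)) := by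
  classical
  rw [LinearMap.trace_eq_matrix_trace ℝ e]
  simp [Matrix.trace, LinearMap.toMatrix_apply]

variable [FiniteDimensional ℝ E]

/-- The vectors `e^i` with `G(e^i, e_j) = δ_{ij}`. -/
def dualVec (G : E → E →L[ℝ] E →L[ℝ] ℝ) (x : E) {ι : Type*} (e : Module.Basis ι ℝ E) (i : ι) : E :=
  (G x).inverse (LinearMap.toContinuousLinearMap (e.coord i))

omit [FiniteDimensional ℝ E] in
theorem trace_comm (S T : E →L[ℝ] E) :
    LinearMap.trace ℝ E (S.comp T : E →L[ℝ] E) = LinearMap.trace ℝ E (T.comp S : E →L[ℝ] E) :=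
  LinearMap.trace_mul_comm ℝ (S : E →ₗ[ℝ] E) (T : E →ₗ[ℝ] E)

namespace IsMetricOn

variable {G : E → E →L[ℝ] E →L[ℝ] ℝ} {U : Set E} {x : E}
  {ι : Type*} [Fintype ι] (e : Module.Basis ι ℝ E)

omit [FiniteDimensional ℝ E] in
-- The connection is torsion free, so the terms containing Γ(X, Y) cancel in the difference.
theorem codazziDefect_eq (h : IsMetricOn G U) (hx : x ∈ U) (B : E → E →L[ℝ] E →L[ℝ] ℝ)
    (X Y Z : E) :
    codazziDefect G B x X Y Z = covDerivForm G B x X Y Z - covDerivForm G B x Y X Z := by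
  rw [codazziDefect, covDerivForm, covDerivForm, h.christoffel_symm hx X Y]
  ring

omit [Fintype ι] in
theorem dualVec_left (h : IsMetricOn G U) (hx : x ∈ U) (i : ι) (v : E) :
    G x (dualVec G x e i) v = e.coord i v := h.apply_inverse_apply hx _ _

omit [Fintype ι] in
theorem dualVec_right (h : IsMetricOn G U) (hx : x ∈ U) (i : ι) (v : E) :
    G x v (dualVec G x e i) = e.coord i v := by
  rw [h.symm x hx, h.dualVec_left e hx]

theorem sum_dualVec_smul (h : IsMetricOn G U) (hx : x ∈ U) (v : E) :
    ∑ i, G x v (dualVec G x e i) • e i = v := by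
  simp_rw [h.dualVec_right e hx]
  exact e.sum_repr v

theorem sum_apply_dualVec (h : IsMetricOn G U) (hx : x ∈ U) :
    ∑ i, G x (e i) (dualVec G x e i) = Module.finrank ℝ E := by
  simp_rw [h.dualVec_right e hx]
  simp [Module.finrank_eq_card_basis e]

theorem ricci_eq_sum (G : E → E →L[ℝ] E →L[ℝ] ℝ) (x X Y : E) :
    ricci G x X Y = ∑ i, e.coord i (riemann G x X (e i) Y) := by
  rw [ricci_apply, trace_eq_sum_coord e]
  rfl

theorem fderiv_ricci (h : IsMetricOn G U) (hx : x ∈ U) (V X Y : E) :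
    fderiv ℝ (ricci G) x V X Y = ∑ i, e.coord i (fderiv ℝ (riemann G) x V X (e i) Y) := by
  have h1 := (((h.differentiableAt_ricci hx).hasDerivAt_line V).apply_const X).apply_const Y
  have hR := ((h.differentiableAt_riemann hx).hasDerivAt_line V).apply_const X
  have h2 := HasDerivAt.fun_sum (u := Finset.univ) fun i _ =>
    (LinearMap.toContinuousLinearMap (e.coord i)).hasFDerivAt.comp_hasDerivAt (0 : ℝ)
      ((hR.apply_const (e i)).apply_const Y)
  refine h1.unique (h2.congr_of_eventuallyEq (Filter.Eventually.of_forall fun t => ?_))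
  exact ricci_eq_sum e G _ X Y

/-- Contraction commutes with ∇: the two terms in which Γ_V meets the contracted pair form the trace
of a commutator, which vanishes. -/
theorem sum_covDeriv_riemann (h : IsMetricOn G U) (hx : x ∈ U) (V X Z : E) :
    ∑ i, e.coord i (covDeriv G (riemann G) x X (e i) Z V)
      = covDerivForm G (ricci G) x V X Z := by
  have h1 := trace_comm (christoffel G x V) ((riemann G x X).flip Z)
  rw [trace_eq_sum_coord e, trace_eq_sum_coord e] at h1
  change ∑ i, e.coord i (christoffel G x V (riemann G x X (e i) Z))
    = ∑ i, e.coord i (riemann G x X (christoffel G x V (e i)) Z) at h1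
  rw [covDerivForm, h.fderiv_ricci e hx, ricci_eq_sum e, ricci_eq_sum e]
  simp only [covDeriv, LinearMap.coe_mk, AddHom.coe_mk, map_add, map_sub, Finset.sum_add_distrib,
    Finset.sum_sub_distrib]
  rw [h1]
  ring

/-- This is the second Bianchi identity for e_i, X, Y, contracted with e^i. The two terms
differentiated along X and Y become covariant derivatives of Ric by `sum_covDeriv_riemann`, one of
them after exchanging the first two arguments of R. -/
theorem divergence_riemann (h : IsMetricOn G U) (hx : x ∈ U) (X Y Z : E) :
    divergence G (riemann G) x X Y Z = -codazziDefect G (ricci G) x X Y Z := by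
  have e := Module.finBasis ℝ E
  rw [h.codazziDefect_eq hx, ← h.sum_covDeriv_riemann e hx, ← h.sum_covDeriv_riemann e hx,
    divergence, trace_eq_sum_coord e, neg_sub, ← Finset.sum_sub_distrib]
  refine Finset.sum_congr rfl fun i _ => ?_
  have hb := h.second_bianchi hx (e i) X Y Z
  have ha : covDeriv G (riemann G) x (e i) X Z Y = -covDeriv G (riemann G) x X (e i) Z Y := by
    have hr : ∀ z X Y Z, riemann G z X Y Z = -riemann G z Y X Z := fun z X Y Z => by
      rw [riemann_antisymm]; rfl
    have hD : fderiv ℝ (riemann G) x Y (e i) X Z = -fderiv ℝ (riemann G) x Y X (e i) Z := by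
      have hR := (h.differentiableAt_riemann hx).hasDerivAt_line Y
      exact (((hR.apply_const (e i)).apply_const X).apply_const Z).unique
        ((((hR.apply_const X).apply_const (e i)).apply_const Z).neg.congr_of_eventuallyEq
          (Filter.Eventually.of_forall fun t => hr _ _ _ _))
    simp only [covDeriv, LinearMap.coe_mk, AddHom.coe_mk]
    rw [hD, hr x (e i) X, hr x (christoffel G x Y (e i)), hr x (e i) (christoffel G x Y X),
      hr x (e i) X, map_neg]
    abel
  have hc : covDeriv G (riemann G) x Y (e i) Z X =
      covDeriv G (riemann G) x X (e i) Z Y - covDeriv G (riemann G) x X Y Z (e i) := by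
    rw [ha] at hb
    rw [eq_sub_iff_add_eq, ← sub_eq_zero, ← hb]
    abel
  rw [hc, map_sub]
  ring

/-- The scalar curvature is the trace of the Ricci operator Q. Since the metric is parallel, ∇Q is
∇Ric with an index raised (`hn`), and ∇_X Q differs from the plain derivative of Q by a commutator,
which has trace zero. -/
theorem fderiv_scalar (h : IsMetricOn G U) (hx : x ∈ U) (X : E) :
    fderiv ℝ (scalar G) x X = ∑ i, covDerivForm G (ricci G) x X (e i) (dualVec G x e i) := by
  set Q : E → E →L[ℝ] E := fun z => (G z).inverse.comp (ricci G z) with hQ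
  have hQd : DifferentiableAt ℝ Q x :=
    ((h.contDiffOn_inverse.clm_comp h.contDiffOn_ricci).contDiffAt
      (h.mem_nhds hx)).differentiableAt (by simp)
  have hQG : ∀ z ∈ U, ∀ u v, G z (Q z u) v = ricci G z u v := fun z hz u v =>
    h.apply_inverse_apply hz _ _
  have hτ : fderiv ℝ (scalar G) x X = traceCLM E (fderiv ℝ Q x X) :=
    ((h.differentiableAt_scalar hx).hasDerivAt_line X).unique
      ((traceCLM E).hasFDerivAt.comp_hasDerivAt (0 : ℝ) (hQd.hasDerivAt_line X))
  have hn : ∀ u v, G x (fderiv ℝ Q x X u + christoffel G x X (Q x u)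
      - Q x (christoffel G x X u)) v = covDerivForm G (ricci G) x X u v := fun u v => by
    have h1 := (((h.differentiableAt_ricci hx).hasDerivAt_line X).apply_const u).apply_const v
    have h2 := (((h.differentiableAt hx).hasDerivAt_line X).clm_apply
      ((hQd.hasDerivAt_line X).apply_const u)).apply_const v
    have h3 := h1.unique (h2.congr_of_eventuallyEq (by
      filter_upwards [eventually_line (h.mem_nhds hx) X] with t ht using (hQG _ ht u v).symm))
    simp only [zero_smul, add_zero, add_apply, h.fderiv_eq hx] at h3
    rw [covDerivForm, h3, ← hQG x hx, ← hQG x hx]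
    simp only [map_add, map_sub, add_apply, sub_apply]
    ring
  have hc := trace_comm (christoffel G x X) (Q x)
  rw [trace_eq_sum_coord e, trace_eq_sum_coord e] at hc
  change ∑ i, e.coord i (christoffel G x X (Q x (e i)))
    = ∑ i, e.coord i (Q x (christoffel G x X (e i))) at hc
  simp_rw [← hn, h.dualVec_right e hx, map_sub, map_add]
  rw [Finset.sum_sub_distrib, Finset.sum_add_distrib, hc, add_sub_cancel_right, hτ, traceCLM_apply,
    trace_eq_sum_coord e]
  rfl

/-- The contracted second Bianchi identity. -/
theorem fderiv_scalar_eq_two_mul (h : IsMetricOn G U) (hx : x ∈ U) (X : E) :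
    fderiv ℝ (scalar G) x X
      = 2 * ∑ i, covDerivForm G (ricci G) x (e i) X (dualVec G x e i) := by
  -- The divergence of R, traced over its last two arguments: skewness of ∇R turns the inner sum
  -- over j into minus the trace that defines ∇Ric.
  have h1 : ∑ j, divergence G (riemann G) x X (e j) (dualVec G x e j)
      = -∑ i, covDerivForm G (ricci G) x (e i) X (dualVec G x e i) := by
    simp_rw [← h.sum_covDeriv_riemann e hx, divergence, trace_eq_sum_coord e]
    rw [Finset.sum_comm, ← Finset.sum_neg_distrib]
    refine Finset.sum_congr rfl fun i _ => ?_
    rw [← Finset.sum_neg_distrib]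
    refine Finset.sum_congr rfl fun j _ => ?_
    rw [← h.dualVec_right e hx, ← h.dualVec_left e hx, h.covDeriv_riemann_skew hx]
  simp_rw [h.divergence_riemann hx, h.codazziDefect_eq hx, neg_sub] at h1
  rw [Finset.sum_sub_distrib, ← h.fderiv_scalar e hx] at h1
  linarith

/-- `metricWedge` is parallel, so ∇C differs from ∇R only by the derivative of the factor τ (`key`);
contracting V with the output vector evaluates dτ at Y and at X. -/
theorem divergence_concircular (h : IsMetricOn G U) (hx : x ∈ U) (X Y Z : E) :
    divergence G (concircular G) x X Y Z = -codazziDefect G (ricci G) x X Y Z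
      - 1 / ((Module.finrank ℝ E : ℝ) * ((Module.finrank ℝ E : ℝ) - 1)) *
        (G x X Z * fderiv ℝ (scalar G) x Y - G x Y Z * fderiv ℝ (scalar G) x X) := by
  set c : ℝ := (Module.finrank ℝ E : ℝ) * ((Module.finrank ℝ E : ℝ) - 1)
  set τ' := fderiv ℝ (scalar G) x with hτ'
  have hW : ContDiffOn ℝ ∞ (metricWedge G) U := by
    have h1 : ContDiffOn ℝ ∞ (fun x => (ContinuousLinearMap.smulRightL ℝ E E).comp (G x)) U :=
      contDiffOn_const.clm_comp h.contDiffOn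
    exact h1.sub ((ContinuousLinearMap.flipₗᵢ ℝ E E (E →L[ℝ] E)).contDiff.comp_contDiffOn h1)
  have hWd : DifferentiableAt ℝ (metricWedge G) x :=
    (hW.contDiffAt (h.mem_nhds hx)).differentiableAt (by simp)
  have hτd : DifferentiableAt ℝ (fun z => scalar G z / c) x := by
    simpa only [div_eq_mul_inv] using (h.differentiableAt_scalar hx).mul_const c⁻¹
  have hCd : DifferentiableAt ℝ (concircular G) x :=
    (h.differentiableAt_riemann hx).fun_sub (hτd.fun_smul hWd)
  have hDW : ∀ V, fderiv ℝ (metricWedge G) x V X Y Z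
      = fderiv ℝ G x V X Z • Y - fderiv ℝ G x V Y Z • X := fun V => by
    have hG := (h.differentiableAt hx).hasDerivAt_line V
    exact ((((hWd.hasDerivAt_line V).apply_const X).apply_const Y).apply_const Z).unique
      (((((hG.apply_const X).apply_const Z).smul_const Y)).sub
        (((hG.apply_const Y).apply_const Z).smul_const X))
  have hDC : ∀ V, fderiv ℝ (concircular G) x V X Y Z = fderiv ℝ (riemann G) x V X Y Z
      - ((scalar G x / c) • fderiv ℝ (metricWedge G) x V X Y Z
        + (τ' V / c) • metricWedge G x X Y Z) := fun V => by
    have hR := (h.differentiableAt_riemann hx).hasDerivAt_line V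
    have hw := hWd.hasDerivAt_line V
    have hτ := ((h.differentiableAt_scalar hx).hasDerivAt_line V).div_const c
    have h2 := (((hR.sub (hτ.smul hw)).apply_const X).apply_const Y).apply_const Z
    have h3 := ((((hCd.hasDerivAt_line V).apply_const X).apply_const Y).apply_const Z).unique h2
    rw [h3]
    simp only [zero_smul, add_zero]
    rfl
  have key : ∀ V, covDeriv G (concircular G) x X Y Z V = covDeriv G (riemann G) x X Y Z V
      - (τ' V / c) • (G x X Z • Y - G x Y Z • X) := fun V => by
    simp only [covDeriv, LinearMap.coe_mk, AddHom.coe_mk, hDC, hDW, h.fderiv_eq hx]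
    have hCx : ∀ X Y Z, concircular G x X Y Z = riemann G x X Y Z
        - (scalar G x / c) • (G x X Z • Y - G x Y Z • X) := fun X Y Z => rfl
    simp only [hCx, map_sub, map_smul, metricWedge_apply]
    module
  set e := Module.finBasis ℝ E
  rw [← h.divergence_riemann hx, divergence, divergence, trace_eq_sum_coord e,
    trace_eq_sum_coord e]
  have hlin : ∀ Y, τ' Y = ∑ i, e.coord i Y * τ' (e i) := fun Y => by
    conv_lhs => rw [← e.sum_repr Y]
    simp only [map_sum, map_smul, smul_eq_mul, Module.Basis.coord_apply]
  rw [hlin X, hlin Y, Finset.mul_sum, Finset.mul_sum, ← Finset.sum_sub_distrib, Finset.mul_sum,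
    ← Finset.sum_sub_distrib]
  refine Finset.sum_congr rfl fun i _ => ?_
  rw [key, map_sub, map_smul, map_sub, map_smul, map_smul]
  simp only [smul_eq_mul]
  ring

theorem sum_codazziDefect_ricci (h : IsMetricOn G U) (hx : x ∈ U) (X : E) :
    ∑ i, codazziDefect G (ricci G) x X (e i) (dualVec G x e i) = fderiv ℝ (scalar G) x X / 2 := by
  simp_rw [h.codazziDefect_eq hx]
  rw [Finset.sum_sub_distrib, ← h.fderiv_scalar e hx]
  linarith [h.fderiv_scalar_eq_two_mul e hx X]

/-- The trace of the Codazzi defect of Ric is dτ/2, so its vanishing also removes the scalar terms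
of div C. No restriction on the dimension enters. -/
theorem divergence_concircular_eq_zero (h : IsMetricOn G U) (hx : x ∈ U)
    (hR : ∀ X Y Z, codazziDefect G (ricci G) x X Y Z = 0) (X Y Z : E) :
    divergence G (concircular G) x X Y Z = 0 := by
  have hτ : ∀ X, fderiv ℝ (scalar G) x X = 0 := fun X => by
    have h1 := h.sum_codazziDefect_ricci (Module.finBasis ℝ E) hx X
    simp only [hR, Finset.sum_const_zero] at h1
    linarith
  rw [h.divergence_concircular hx, hR, hτ, hτ]
  ring

/-- The argument is linear algebra at the single point x. This matters because on a manifold the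
divergence is only evaluated at the centre of each chart. -/
theorem codazziDefect_ricci_eq_zero (h : IsMetricOn G U) (hx : x ∈ U)
    (hdim : 3 ≤ Module.finrank ℝ E)
    (hC : ∀ X Y Z, divergence G (concircular G) x X Y Z = 0) (X Y Z : E) :
    codazziDefect G (ricci G) x X Y Z = 0 := by
  have e := Module.finBasis ℝ E
  have hm : (3 : ℝ) ≤ Module.finrank ℝ E := by exact_mod_cast hdim
  have hD : ∀ X Y Z, codazziDefect G (ricci G) x X Y Z
      = -(1 / ((Module.finrank ℝ E : ℝ) * ((Module.finrank ℝ E : ℝ) - 1)) *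
        (G x X Z * fderiv ℝ (scalar G) x Y - G x Y Z * fderiv ℝ (scalar G) x X)) :=
    fun X Y Z => by linarith [h.divergence_concircular hx X Y Z, hC X Y Z]
  have hτ : ∀ X, fderiv ℝ (scalar G) x X = 0 := fun X => by
    have h1 := h.sum_codazziDefect_ricci e hx X
    have h2 : ∑ i, G x X (dualVec G x e i) * fderiv ℝ (scalar G) x (e i)
        = fderiv ℝ (scalar G) x X := by
      conv_rhs => rw [← h.sum_dualVec_smul e hx X]
      simp only [map_sum, map_smul, smul_eq_mul]
    simp_rw [hD] at h1
    rw [Finset.sum_neg_distrib, ← Finset.mul_sum, Finset.sum_sub_distrib, h2, ← Finset.sum_mul,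
      h.sum_apply_dualVec e hx] at h1
    set m : ℝ := ((Module.finrank ℝ E : ℕ) : ℝ)
    have h3 : m - 1 ≠ 0 := by linarith
    have h3' : m ≠ 0 := by linarith
    have h3'' : (m * (m - 1)) * (1 / (m * (m - 1))) = 1 := mul_one_div_cancel (mul_ne_zero h3' h3)
    have h5 := congrArg (fun r => m * (m - 1) * r) h1
    simp only [mul_neg, ← mul_assoc, h3''] at h5
    -- The traced equation is dτ/m = dτ/2, multiplied through by m(m - 1); m ≥ 3 excludes the roots
    -- 1 and 2.
    have h4 : (m - 2) * (m - 1) * fderiv ℝ (scalar G) x X = 0 := by linarith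
    exact (mul_eq_zero.1 h4).resolve_left (mul_ne_zero (by linarith) (by linarith))
  rw [hD, hτ, hτ]
  ring

end IsMetricOn

end LocalGeometry

/-! ### The warping function: logarithmic differential, gradient and Hessian -/

namespace LocalGeometry

section Warping

variable {E : Type*} [NormedAddCommGroup E] [NormedSpace ℝ E]

/-- The one-form `d (log F)`. -/
def logDifferential (F : E → ℝ) : E → E →L[ℝ] ℝ := fderiv ℝ fun x => Real.log (F x)

/-- The tensor `(1 / F) H^F`, written in terms of `d (log F)`,
see `IsMetricOn.hessian_eq`. -/
def hessianRatio (G : E → E →L[ℝ] E →L[ℝ] ℝ) (F : E → ℝ) (x : E) : E →L[ℝ] E →L[ℝ] ℝ :=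
  fderiv ℝ (logDifferential F) x + (logDifferential F x).smulRight (logDifferential F x)
    - (ContinuousLinearMap.compL ℝ E E ℝ (logDifferential F x)).comp (christoffel G x)

theorem hessianRatio_apply (G : E → E →L[ℝ] E →L[ℝ] ℝ) (F : E → ℝ) (x Y Z : E) :
    hessianRatio G F x Y Z = fderiv ℝ (logDifferential F) x Y Z
      + logDifferential F x Y * logDifferential F x Z
      - logDifferential F x (christoffel G x Y Z) := rfl

/-- The endomorphism `Y ↦ ∇_Y grad F`. -/
def covDerivGrad (G : E → E →L[ℝ] E →L[ℝ] ℝ) (F : E → ℝ) (x : E) : E →L[ℝ] E :=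
  fderiv ℝ (grad G F) x + (christoffel G x).flip (grad G F x)

theorem covDerivGrad_apply (G : E → E →L[ℝ] E →L[ℝ] ℝ) (F : E → ℝ) (x Y : E) :
    covDerivGrad G F x Y = fderiv ℝ (grad G F) x Y + christoffel G x Y (grad G F x) := rfl

variable {F : E → ℝ} {U : Set E} {x : E}

theorem contDiffOn_logDifferential (hU : IsOpen U) (hF : ContDiffOn ℝ ∞ F U)
    (hpos : ∀ x ∈ U, 0 < F x) : ContDiffOn ℝ ∞ (logDifferential F) U :=
  (hF.log fun x hx => (hpos x hx).ne').fderiv_of_isOpen hU (by simp)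

theorem fderiv_eq_mul_logDifferential (hU : IsOpen U) (hF : ContDiffOn ℝ ∞ F U)
    (hpos : ∀ x ∈ U, 0 < F x) (hx : x ∈ U) (v : E) :
    fderiv ℝ F x v = F x * logDifferential F x v := by
  have hd : DifferentiableAt ℝ F x :=
    (hF.contDiffAt (hU.mem_nhds hx)).differentiableAt (by simp)
  rw [logDifferential, fderiv.log hd (hpos x hx).ne', smul_apply, smul_eq_mul,
    mul_inv_cancel_left₀ (hpos x hx).ne']

theorem fderiv_logDifferential_symm (hU : IsOpen U) (hF : ContDiffOn ℝ ∞ F U)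
    (hpos : ∀ x ∈ U, 0 < F x) (hx : x ∈ U) (Y Z : E) :
    fderiv ℝ (logDifferential F) x Y Z = fderiv ℝ (logDifferential F) x Z Y :=
  ((hF.log fun x hx => (hpos x hx).ne').contDiffAt (hU.mem_nhds hx)).isSymmSndFDerivAt
    (by simpa using WithTop.coe_le_coe.2 (le_top : (2 : ℕ∞) ≤ ⊤)) Y Z

theorem snd_fderiv_logDifferential_symm (hU : IsOpen U) (hF : ContDiffOn ℝ ∞ F U)
    (hpos : ∀ x ∈ U, 0 < F x) (hx : x ∈ U) (Y Z : E) :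
    fderiv ℝ (fderiv ℝ (logDifferential F)) x Y Z
      = fderiv ℝ (fderiv ℝ (logDifferential F)) x Z Y :=
  ((contDiffOn_logDifferential hU hF hpos).contDiffAt (hU.mem_nhds hx)).isSymmSndFDerivAt
    (by simpa using WithTop.coe_le_coe.2 (le_top : (2 : ℕ∞) ≤ ⊤)) Y Z

variable [FiniteDimensional ℝ E] {G : E → E →L[ℝ] E →L[ℝ] ℝ}

namespace IsMetricOn

theorem apply_grad (h : IsMetricOn G U) (hF : ContDiffOn ℝ ∞ F U) (hpos : ∀ x ∈ U, 0 < F x)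
    (hx : x ∈ U) (v : E) : G x (grad G F x) v = F x * logDifferential F x v := by
  rw [grad, h.apply_inverse_apply hx, fderiv_eq_mul_logDifferential h.isOpen hF hpos hx]

theorem contDiffOn_grad (h : IsMetricOn G U) (hF : ContDiffOn ℝ ∞ F U) :
    ContDiffOn ℝ ∞ (grad G F) U :=
  h.contDiffOn_inverse.clm_apply (hF.fderiv_of_isOpen h.isOpen (by simp))

theorem contDiffOn_covDerivGrad (h : IsMetricOn G U) (hF : ContDiffOn ℝ ∞ F U) :
    ContDiffOn ℝ ∞ (covDerivGrad G F) U :=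
  ((h.contDiffOn_grad hF).fderiv_of_isOpen h.isOpen (by simp)).add
    (((ContinuousLinearMap.flipₗᵢ ℝ E E E).contDiff.comp_contDiffOn
      h.contDiffOn_christoffel).clm_apply (h.contDiffOn_grad hF))

theorem contDiffOn_hessianRatio (h : IsMetricOn G U) (hF : ContDiffOn ℝ ∞ F U)
    (hpos : ∀ x ∈ U, 0 < F x) : ContDiffOn ℝ ∞ (hessianRatio G F) U := by
  have hL := contDiffOn_logDifferential h.isOpen hF hpos
  have h1 : ContDiffOn ℝ ∞
      (fun x => (logDifferential F x).smulRight (logDifferential F x)) U :=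
    ((ContinuousLinearMap.smulRightL ℝ E (E →L[ℝ] ℝ)).contDiff.comp_contDiffOn hL).clm_apply hL
  have h2 : ContDiffOn ℝ ∞ (fun x => ContinuousLinearMap.compL ℝ E E ℝ (logDifferential F x)) U :=
    (ContinuousLinearMap.compL ℝ E E ℝ).contDiff.comp_contDiffOn hL
  exact ((hL.fderiv_of_isOpen h.isOpen (by simp)).add h1).sub
    (h2.clm_comp h.contDiffOn_christoffel)

/-- Differentiate G(grad F, Z) = F · d(log F)(Z) along Y and use metric compatibility on the left;
the product rule on the right produces the square of d(log F). -/
theorem hessian_eq (h : IsMetricOn G U) (hF : ContDiffOn ℝ ∞ F U) (hpos : ∀ x ∈ U, 0 < F x)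
    (hx : x ∈ U) (Y Z : E) : hessian G F x Y Z = F x * hessianRatio G F x Y Z := by
  have hL := ((contDiffOn_logDifferential h.isOpen hF hpos).contDiffAt
    (h.mem_nhds hx)).differentiableAt (by simp)
  have hN := ((h.contDiffOn_grad hF).contDiffAt (h.mem_nhds hx)).differentiableAt (by simp)
  have hFd : DifferentiableAt ℝ F x :=
    (hF.contDiffAt (h.mem_nhds hx)).differentiableAt (by simp)
  have h1 := (((h.differentiableAt hx).hasDerivAt_line Y).clm_apply
    (hN.hasDerivAt_line Y)).apply_const Z
  have h2 := (hFd.hasDerivAt_line Y).mul ((hL.hasDerivAt_line Y).apply_const Z)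
  have h3 := h1.unique (h2.congr_of_eventuallyEq (by
    filter_upwards [eventually_line (h.mem_nhds hx) Y] with t ht using
      h.apply_grad hF hpos ht Z))
  simp only [zero_smul, add_zero, add_apply, h.fderiv_eq hx, h.apply_grad hF hpos hx,
    fderiv_eq_mul_logDifferential h.isOpen hF hpos hx] at h3
  rw [hessian, hessianRatio_apply, map_add, add_apply]
  linarith

/-- Write L = d(log F), so that the tensor is ∇L + L ⊗ L. Antisymmetrizing ∇∇L gives L(R(X, Y)Z),
the Ricci identity. In the defect of L ⊗ L the symmetric ∇L cancels against itself, and completing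
the remaining ∇L to the full tensor costs only cubic terms in L that also cancel. -/
theorem codazziDefect_hessianRatio (h : IsMetricOn G U) (hF : ContDiffOn ℝ ∞ F U)
    (hpos : ∀ x ∈ U, 0 < F x) (hx : x ∈ U) (X Y Z : E) :
    codazziDefect G (hessianRatio G F) x X Y Z
      = logDifferential F x (riemann G x X Y Z)
        + logDifferential F x Y * hessianRatio G F x X Z
        - logDifferential F x X * hessianRatio G F x Y Z := by
  have hLc := contDiffOn_logDifferential h.isOpen hF hpos
  have hL := (hLc.contDiffAt (h.mem_nhds hx)).differentiableAt (by simp)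
  have hDL := ((hLc.fderiv_of_isOpen h.isOpen (by simp : (∞ : ℕ∞ω) + 1 ≤ ∞)).contDiffAt
    (h.mem_nhds hx)).differentiableAt (by simp)
  have hK := ((h.contDiffOn_hessianRatio hF hpos).contDiffAt
    (h.mem_nhds hx)).differentiableAt (by simp)
  have hD : ∀ V Y, fderiv ℝ (hessianRatio G F) x V Y Z =
      fderiv ℝ (fderiv ℝ (logDifferential F)) x V Y Z
        + (fderiv ℝ (logDifferential F) x V Y * logDifferential F x Z
          + logDifferential F x Y * fderiv ℝ (logDifferential F) x V Z)
        - (fderiv ℝ (logDifferential F) x V (christoffel G x Y Z)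
          + logDifferential F x (fderiv ℝ (christoffel G) x V Y Z)) := fun V Y => by
    have hl := hL.hasDerivAt_line V
    have hΓ := (((h.differentiableAt_christoffel hx).hasDerivAt_line V).apply_const
      Y).apply_const Z
    have h2 := ((((hDL.hasDerivAt_line V).apply_const Y).apply_const Z).add
      ((hl.apply_const Y).mul (hl.apply_const Z))).sub (hl.clm_apply hΓ)
    have h3 := (((hK.hasDerivAt_line V).apply_const Y).apply_const Z).unique h2
    simpa only [zero_smul, add_zero] using h3
  rw [codazziDefect, hD, hD, snd_fderiv_logDifferential_symm h.isOpen hF hpos hx Y X,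
    fderiv_logDifferential_symm h.isOpen hF hpos hx Y X]
  simp only [hessianRatio_apply, riemann_apply, secondDeriv_apply, map_sub, map_add]
  ring

end IsMetricOn

end Warping

/-- `G = G₁ + F² G₂` on `U₁ × U₂`. -/
structure IsWarpedOn {E₁ E₂ : Type*} [NormedAddCommGroup E₁] [NormedSpace ℝ E₁]
    [NormedAddCommGroup E₂] [NormedSpace ℝ E₂]
    (G₁ : E₁ → E₁ →L[ℝ] E₁ →L[ℝ] ℝ) (U₁ : Set E₁) (G₂ : E₂ → E₂ →L[ℝ] E₂ →L[ℝ] ℝ) (U₂ : Set E₂)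
    (F : E₁ → ℝ) (G : E₁ × E₂ → E₁ × E₂ →L[ℝ] E₁ × E₂ →L[ℝ] ℝ) : Prop where
  left : IsMetricOn G₁ U₁
  right : IsMetricOn G₂ U₂
  smooth : ContDiffOn ℝ ∞ F U₁
  pos : ∀ x ∈ U₁, 0 < F x
  total : IsMetricOn G (U₁ ×ˢ U₂)
  apply_eq : ∀ x ∈ U₁, ∀ y ∈ U₂, ∀ u v : E₁ × E₂,
    G (x, y) u v = G₁ x u.1 v.1 + F x ^ 2 * G₂ y u.2 v.2

/-- The function `F ΔF + (n - 1) |grad F|²` in the Ricci tensor of a warped product with fibres of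
dimension `n`. -/
def warpingTerm {E : Type*} [NormedAddCommGroup E] [NormedSpace ℝ E] [FiniteDimensional ℝ E]
    (G : E → E →L[ℝ] E →L[ℝ] ℝ) (F : E → ℝ) (n : ℕ) (x : E) : ℝ :=
  F x * traceCLM E (covDerivGrad G F x)
    + ((n : ℝ) - 1) * (F x * logDifferential F x (grad G F x))

/-! ### Connection, Ricci tensor and Codazzi equations of a warped product -/

namespace IsWarpedOn

variable {E₁ E₂ : Type*} [NormedAddCommGroup E₁] [NormedSpace ℝ E₁]
    [NormedAddCommGroup E₂] [NormedSpace ℝ E₂]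
    {G₁ : E₁ → E₁ →L[ℝ] E₁ →L[ℝ] ℝ} {U₁ : Set E₁} {G₂ : E₂ → E₂ →L[ℝ] E₂ →L[ℝ] ℝ} {U₂ : Set E₂}
    {F : E₁ → ℝ} {G : E₁ × E₂ → E₁ × E₂ →L[ℝ] E₁ × E₂ →L[ℝ] ℝ} {x : E₁} {y : E₂}

section

variable (h : IsWarpedOn G₁ U₁ G₂ U₂ F G) (hx : x ∈ U₁) (hy : y ∈ U₂)
include h hx

theorem differentiableAt_warping : DifferentiableAt ℝ F x :=
  (h.smooth.contDiffAt (h.left.mem_nhds hx)).differentiableAt (by simp)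

theorem differentiableAt_logDifferential : DifferentiableAt ℝ (logDifferential F) x :=
  ((contDiffOn_logDifferential h.left.isOpen h.smooth h.pos).contDiffAt
    (h.left.mem_nhds hx)).differentiableAt (by simp)

theorem fderiv_warping (v : E₁) : fderiv ℝ F x v = F x * logDifferential F x v :=
  fderiv_eq_mul_logDifferential h.left.isOpen h.smooth h.pos hx v

variable [FiniteDimensional ℝ E₁]

theorem differentiableAt_grad : DifferentiableAt ℝ (grad G₁ F) x :=
  ((h.left.contDiffOn_grad h.smooth).contDiffAt (h.left.mem_nhds hx)).differentiableAt (by simp)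

theorem differentiableAt_warpingTerm (n : ℕ) : DifferentiableAt ℝ (warpingTerm G₁ F n) x := by
  have hN := h.differentiableAt_grad hx
  have hC : DifferentiableAt ℝ (covDerivGrad G₁ F) x :=
    ((h.left.contDiffOn_covDerivGrad h.smooth).contDiffAt
      (h.left.mem_nhds hx)).differentiableAt (by simp)
  have hT : DifferentiableAt ℝ (fun z => traceCLM E₁ (covDerivGrad G₁ F z)) x :=
    (traceCLM E₁).differentiableAt.comp x hC
  have hF := h.differentiableAt_warping hx
  have hL := (h.differentiableAt_logDifferential hx).clm_apply hN
  exact (hF.fun_mul hT).fun_add ((hF.fun_mul hL).const_mul _)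

variable [FiniteDimensional ℝ E₂]
include hy

omit [FiniteDimensional ℝ E₁] [FiniteDimensional ℝ E₂] in
theorem fderiv_apply (a b c : E₁ × E₂) :
    fderiv ℝ G (x, y) a b c = fderiv ℝ G₁ x a.1 b.1 c.1
      + F x ^ 2 * (fderiv ℝ G₂ y a.2 b.2 c.2 + 2 * logDifferential F x a.1 * G₂ y b.2 c.2) := by
  have hz := mk_mem_prod hx hy
  have h1 := (((h.total.differentiableAt hz).hasDerivAt_line a).apply_const b).apply_const c
  have h2 := ((((h.left.differentiableAt hx).hasDerivAt_line a.1).apply_const b.1).apply_const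
    c.1).add ((((h.differentiableAt_warping hx).hasDerivAt_line a.1).fun_pow 2).mul
      ((((h.right.differentiableAt hy).hasDerivAt_line a.2).apply_const b.2).apply_const c.2))
  rw [h1.unique (h2.congr_of_eventuallyEq ?_)]
  · simp only [zero_smul, add_zero, h.fderiv_warping hx]
    push_cast
    ring
  · filter_upwards [eventually_line (h.total.mem_nhds hz) a] with t ht using
      h.apply_eq _ ht.1 _ ht.2 _ _

/-- Pairing with an arbitrary w reduces this to the Koszul formula. Differentiating F² along u or v
gives the logarithmic terms in the fibre; differentiating it along w gives the gradient term in the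
base. -/
theorem christoffel_eq (u v : E₁ × E₂) :
    christoffel G (x, y) u v =
      (christoffel G₁ x u.1 v.1 - (F x * G₂ y u.2 v.2) • grad G₁ F x,
        christoffel G₂ y u.2 v.2 + logDifferential F x u.1 • v.2
          + logDifferential F x v.1 • u.2) := by
  refine h.total.ext_left (mk_mem_prod hx hy) fun w => ?_
  rw [christoffel_apply, h.total.apply_inverse_apply (mk_mem_prod hx hy), christoffelLower_apply,
    h.fderiv_apply hx hy, h.fderiv_apply hx hy, h.fderiv_apply hx hy, h.apply_eq x hx y hy]
  have h1 : G₁ x (christoffel G₁ x u.1 v.1) w.1 = christoffelLower G₁ x u.1 v.1 w.1 :=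
    h.left.apply_inverse_apply hx _ _
  have h2 : G₂ y (christoffel G₂ y u.2 v.2) w.2 = christoffelLower G₂ y u.2 v.2 w.2 :=
    h.right.apply_inverse_apply hy _ _
  simp only [map_add, map_sub, map_smul, add_apply, sub_apply, smul_apply, smul_eq_mul, h1, h2,
    christoffelLower_apply, h.left.apply_grad h.smooth h.pos hx]
  rw [h.right.symm y hy v.2 w.2]
  ring

theorem fderiv_christoffel_eq (w u v : E₁ × E₂) :
    fderiv ℝ (christoffel G) (x, y) w u v =
      (fderiv ℝ (christoffel G₁) x w.1 u.1 v.1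
        - ((F x * G₂ y u.2 v.2) • fderiv ℝ (grad G₁ F) x w.1
          + (F x * logDifferential F x w.1 * G₂ y u.2 v.2
            + F x * fderiv ℝ G₂ y w.2 u.2 v.2) • grad G₁ F x),
        fderiv ℝ (christoffel G₂) y w.2 u.2 v.2 + fderiv ℝ (logDifferential F) x w.1 u.1 • v.2
          + fderiv ℝ (logDifferential F) x w.1 v.1 • u.2) := by
  have hz := mk_mem_prod hx hy
  have h1 := (((h.total.differentiableAt_christoffel hz).hasDerivAt_line w).apply_const
    u).apply_const v
  have hL := (h.differentiableAt_logDifferential hx).hasDerivAt_line w.1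
  have hf : HasDerivAt (fun t : ℝ => F (x + t • w.1)) (fderiv ℝ F x w.1) 0 :=
    (h.differentiableAt_warping hx).hasDerivAt_line w.1
  have hg := (((h.right.differentiableAt hy).hasDerivAt_line w.2).apply_const u.2).apply_const v.2
  have h2 := ((((h.left.differentiableAt_christoffel hx).hasDerivAt_line w.1).apply_const
      u.1).apply_const v.1).sub ((hf.mul hg).smul ((h.differentiableAt_grad hx).hasDerivAt_line w.1))
  have h3 := (((((h.right.differentiableAt_christoffel hy).hasDerivAt_line w.2).apply_const
      u.2).apply_const v.2).add ((hL.apply_const u.1).smul_const v.2)).add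
      ((hL.apply_const v.1).smul_const u.2)
  rw [h1.unique ((h2.prodMk h3).congr_of_eventuallyEq ?_)]
  · simp only [zero_smul, add_zero, h.fderiv_warping hx, Pi.mul_apply]
  · filter_upwards [eventually_line (h.total.mem_nhds hz) w] with t ht using
      h.christoffel_eq ht.1 ht.2 _ _

/-- In a basis adapted to the product, the Ricci trace sees only the base component for base vectors
w and, in `riemann_inr_snd`, the fibre component for fibre vectors w. -/
theorem riemann_inl_fst (u v : E₁ × E₂) (w : E₁) :
    (riemann G (x, y) u (w, 0) v).1 = riemann G₁ x u.1 w v.1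
      - (F x * G₂ y u.2 v.2) • covDerivGrad G₁ F x w := by
  simp only [riemann_apply, secondDeriv_apply, h.fderiv_christoffel_eq hx hy,
    h.christoffel_eq hx hy, Prod.fst_add, Prod.fst_sub, covDerivGrad_apply, map_zero, map_add,
    map_sub, map_smul, zero_apply, smul_zero, add_zero, zero_add, mul_zero, zero_smul, sub_zero,
    smul_eq_mul]
  module

theorem riemann_inr_snd (u v : E₁ × E₂) (w : E₂) :
    (riemann G (x, y) u (0, w) v).2 = riemann G₂ y u.2 w v.2
      - hessianRatio G₁ F x u.1 v.1 • w
      - (F x * logDifferential F x (grad G₁ F x)) • (G₂ y u.2 v.2 • w - G₂ y w v.2 • u.2) := by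
  simp only [riemann_apply, secondDeriv_apply, h.fderiv_christoffel_eq hx hy,
    h.christoffel_eq hx hy, Prod.snd_add, Prod.snd_sub, hessianRatio_apply, map_zero, map_add,
    map_sub, map_smul, zero_apply, smul_zero, add_zero, zero_add, mul_zero, zero_smul, sub_zero,
    smul_eq_mul]
  rw [h.right.christoffel_symm hy w u.2]
  module

/-- The trace splits into a base and a fibre block. In the fibre, w ↦ w has trace n, while w ↦ G₂(u,
v) w - G₂(w, v) u has trace (n - 1) G₂(u, v); this is the source of the factor n - 1 in
`warpingTerm`. -/
theorem ricci_eq (u v : E₁ × E₂) :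
    ricci G (x, y) u v =
      (ricci G₁ x u.1 v.1 - Module.finrank ℝ E₂ * hessianRatio G₁ F x u.1 v.1)
        + (ricci G₂ y u.2 v.2
          - warpingTerm G₁ F (Module.finrank ℝ E₂) x * G₂ y u.2 v.2) := by
  set e₁ := Module.finBasis ℝ E₁
  set e₂ := Module.finBasis ℝ E₂
  rw [IsMetricOn.ricci_eq_sum (e₁.prod e₂), Fintype.sum_sum_type]
  have h1 : ∀ i, (e₁.prod e₂).coord (Sum.inl i) (riemann G (x, y) u (e₁.prod e₂ (Sum.inl i)) v)
      = e₁.coord i (riemann G₁ x u.1 (e₁ i) v.1)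
        - F x * G₂ y u.2 v.2 * e₁.coord i (covDerivGrad G₁ F x (e₁ i)) := fun i => by
    have hb : e₁.prod e₂ (Sum.inl i) = (e₁ i, 0) := by
      ext <;> simp
    rw [hb, Module.Basis.coord_apply, Module.Basis.prod_repr_inl, h.riemann_inl_fst hx hy,
      ← Module.Basis.coord_apply, map_sub, map_smul, smul_eq_mul]
  have h2 : ∀ i, (e₁.prod e₂).coord (Sum.inr i) (riemann G (x, y) u (e₁.prod e₂ (Sum.inr i)) v)
      = e₂.coord i (riemann G₂ y u.2 (e₂ i) v.2) - hessianRatio G₁ F x u.1 v.1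
        - (F x * logDifferential F x (grad G₁ F x)) *
          (G₂ y u.2 v.2 - e₂.coord i u.2 * G₂ y (e₂ i) v.2) := fun i => by
    have hb : e₁.prod e₂ (Sum.inr i) = (0, e₂ i) := by
      ext <;> simp
    have hc : e₂.coord i (e₂ i) = 1 := by simp
    rw [hb, Module.Basis.coord_apply, Module.Basis.prod_repr_inr, h.riemann_inr_snd hx hy,
      ← Module.Basis.coord_apply]
    simp only [map_sub, map_smul, smul_eq_mul, hc]
    ring
  have h3 : ∑ i, e₂.coord i u.2 * G₂ y (e₂ i) v.2 = G₂ y u.2 v.2 := by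
    conv_rhs => rw [← e₂.sum_repr u.2]
    simp only [map_sum, map_smul, sum_apply, smul_apply, smul_eq_mul,
      Module.Basis.coord_apply]
  simp only [h1, h2, Finset.sum_sub_distrib, ← Finset.mul_sum, h3, Finset.sum_const,
    Finset.card_univ, Fintype.card_fin, nsmul_eq_mul]
  rw [← IsMetricOn.ricci_eq_sum e₁, ← IsMetricOn.ricci_eq_sum e₂, warpingTerm, traceCLM_apply,
    trace_eq_sum_coord e₁]
  simp only [ContinuousLinearMap.coe_coe]
  ring

theorem fderiv_ricci_eq (a b c : E₁ × E₂) :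
    fderiv ℝ (ricci G) (x, y) a b c =
      (fderiv ℝ (ricci G₁) x a.1 b.1 c.1
        - Module.finrank ℝ E₂ * fderiv ℝ (hessianRatio G₁ F) x a.1 b.1 c.1)
      + (fderiv ℝ (ricci G₂) y a.2 b.2 c.2
        - (fderiv ℝ (warpingTerm G₁ F (Module.finrank ℝ E₂)) x a.1 * G₂ y b.2 c.2
          + warpingTerm G₁ F (Module.finrank ℝ E₂) x * fderiv ℝ G₂ y a.2 b.2 c.2)) := by
  have hz := mk_mem_prod hx hy
  have h1 := (((h.total.differentiableAt_ricci hz).hasDerivAt_line a).apply_const b).apply_const c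
  have hK := ((h.left.contDiffOn_hessianRatio h.smooth h.pos).contDiffAt
    (h.left.mem_nhds hx)).differentiableAt (by simp)
  have h2 := (((((h.left.differentiableAt_ricci hx).hasDerivAt_line a.1).apply_const
      b.1).apply_const c.1).sub ((((hK.hasDerivAt_line a.1).apply_const b.1).apply_const
        c.1).const_mul (Module.finrank ℝ E₂ : ℝ))).add
    (((((h.right.differentiableAt_ricci hy).hasDerivAt_line a.2).apply_const
      b.2).apply_const c.2).sub
      (((h.differentiableAt_warpingTerm hx (Module.finrank ℝ E₂)).hasDerivAt_line a.1).mul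
        ((((h.right.differentiableAt hy).hasDerivAt_line a.2).apply_const b.2).apply_const c.2)))
  rw [h1.unique (h2.congr_of_eventuallyEq ?_)]
  · simp only [zero_smul, add_zero]
  · filter_upwards [eventually_line (h.total.mem_nhds hz) a] with t ht using
      h.ricci_eq ht.1 ht.2 _ _

theorem codazziDefect_base (X Y Z : E₁) :
    codazziDefect G (ricci G) (x, y) (X, 0) (Y, 0) (Z, 0) =
      codazziDefect G₁ (ricci G₁) x X Y Z
        - Module.finrank ℝ E₂ * codazziDefect G₁ (hessianRatio G₁ F) x X Y Z := by
  simp only [codazziDefect, h.fderiv_ricci_eq hx hy, h.ricci_eq hx hy, h.christoffel_eq hx hy,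
    map_zero, smul_zero, add_zero, mul_zero, zero_smul, sub_zero]
  ring

/-- Christoffel symbols of fibre vectors do have a base component along grad F, but Ric has no mixed
entries, so it drops out. The warping term multiplies G₂, which is parallel along the fibre. -/
theorem codazziDefect_fibre (X Y Z : E₂) :
    codazziDefect G (ricci G) (x, y) (0, X) (0, Y) (0, Z) =
      codazziDefect G₂ (ricci G₂) y X Y Z := by
  simp only [codazziDefect, h.fderiv_ricci_eq hx hy, h.ricci_eq hx hy, h.christoffel_eq hx hy,
    map_zero, zero_apply, add_zero, mul_zero, zero_smul, sub_zero, zero_add,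
    h.right.fderiv_eq hy]
  rw [h.right.christoffel_symm hy Y X]
  ring

/-- Here the base component of Γ(V, W), a multiple of G₂(V, W) grad F, does contribute. Apart from
the Ric² term, everything is G₂ times a coefficient that does not involve y, and this makes the
Einstein factor a constant. -/
theorem codazziDefect_mixed (X : E₁) (V W : E₂) :
    codazziDefect G (ricci G) (x, y) (X, 0) (0, V) (0, W) =
      -(logDifferential F x X * ricci G₂ y V W)
      + (logDifferential F x X * warpingTerm G₁ F (Module.finrank ℝ E₂) x
        - fderiv ℝ (warpingTerm G₁ F (Module.finrank ℝ E₂)) x X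
        - F x * (ricci G₁ x X (grad G₁ F x)
          - Module.finrank ℝ E₂ * hessianRatio G₁ F x X (grad G₁ F x))) * G₂ y V W := by
  simp only [codazziDefect, h.fderiv_ricci_eq hx hy, h.ricci_eq hx hy, h.christoffel_eq hx hy,
    map_zero, zero_apply, add_zero, mul_zero, zero_smul, sub_zero, zero_add, smul_zero,
    zero_sub, map_neg, map_smul, smul_eq_mul]
  ring

end

end IsWarpedOn

end LocalGeometry

/-! ### From manifolds to charts -/

section Chart

variable {E : Type*} [NormedAddCommGroup E] [NormedSpace ℝ E]
  {H : Type*} [TopologicalSpace H] {I : ModelWithCorners ℝ E H} [I.Boundaryless]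
  {M : Type*} [TopologicalSpace M] [ChartedSpace H M] [IsManifold I ∞ M]

/-- The derivative of the inverse chart is an isomorphism, so every tangent vector at the image
point is available for testing. -/
theorem tensorInChart_nondegenerate
    (b : ∀ x : M, TangentSpace I x →L[ℝ] TangentSpace I x →L[ℝ] ℝ)
    (hb : ∀ (x : M) (v : TangentSpace I x), (∀ w : TangentSpace I x, b x v w = 0) → v = 0)
    (p : M) {y : E} (hy : y ∈ (extChartAt I p).target) (u : E)
    (hu : ∀ v, tensorInChart I b p y u v = 0) : u = 0 := by
  have : IsManifold I 1 M := IsManifold.of_le (n := ∞) (by simp)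
  have hinv := isInvertible_mfderivWithin_extChartAt_symm (I := I) hy
  rw [I.range_eq_univ, mfderivWithin_univ] at hinv
  obtain ⟨e, he⟩ := hinv
  have h0 : e u = 0 := by
    refine hb _ _ fun w => ?_
    have h1 : b ((extChartAt I p).symm y) (mfderiv 𝓘(ℝ, E) I (extChartAt I p).symm y u)
      (mfderiv 𝓘(ℝ, E) I (extChartAt I p).symm y (e.symm w)) = 0 := hu (e.symm w)
    rw [← he, ContinuousLinearEquiv.coe_coe, e.apply_symm_apply w] at h1
    exact h1
  exact e.map_eq_zero_iff.1 h0

theorem PseudoRiemannianMetric.isMetricOn_inChart (g : PseudoRiemannianMetric I M) (p : M) :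
    LocalGeometry.IsMetricOn (g.inChart p) (extChartAt I p).target where
  isOpen := isOpen_extChartAt_target p
  contDiffOn := g.smooth p
  symm y _ u v := by
    rw [PseudoRiemannianMetric.inChart, tensorInChart_apply, tensorInChart_apply, g.symm]
  nondegenerate _ hy := tensorInChart_nondegenerate g.val g.nondegenerate p hy

omit [I.Boundaryless] in
theorem contDiffOn_comp_extChartAt_symm {f : M → ℝ} (hf : ContMDiff I 𝓘(ℝ, ℝ) ∞ f) (p : M) :
    ContDiffOn ℝ ∞ (f ∘ (extChartAt I p).symm) (extChartAt I p).target :=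
  (hf.comp_contMDiffOn (contMDiffOn_extChartAt_symm p)).contDiffOn

omit [IsManifold I ∞ M] in
theorem dirDeriv_eq_fderiv {f : M → ℝ} (hf : ContMDiff I 𝓘(ℝ, ℝ) ∞ f) (p : M)
    (X : TangentSpace I p) :
    dirDeriv I f p X = fderiv ℝ (f ∘ (extChartAt I p).symm) (extChartAt I p p) (X : E) := by
  rw [dirDeriv, (hf.mdifferentiable (by simp) p).mfderiv, I.range_eq_univ, fderivWithin_univ]
  rfl

/-- In a chart the derivative vanishes on the open target, so the level set through the centre is
open there; f is locally constant, and connectedness finishes. -/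
theorem exists_eq_const_of_dirDeriv_eq_zero [ConnectedSpace M] {f : M → ℝ}
    (hf : ContMDiff I 𝓘(ℝ, ℝ) ∞ f) (h : ∀ (p : M) (X : TangentSpace I p), dirDeriv I f p X = 0) :
    ∃ c : ℝ, ∀ p, f p = c := by
  suffices hc : IsLocallyConstant f by
    obtain ⟨c, hc⟩ := hc.exists_eq_const
    exact ⟨c, congrFun hc⟩
  refine (IsLocallyConstant.iff_eventually_eq f).2 fun p => ?_
  have hd := (contDiffOn_comp_extChartAt_symm hf p).differentiableOn (by simp)
  have ho := isOpen_extChartAt_target (I := I) p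
  have hz : EqOn (fderiv ℝ (f ∘ (extChartAt I p).symm)) 0 (extChartAt I p).target :=
    fun y hy => by
    have h1 : MDifferentiableAt 𝓘(ℝ, E) I (extChartAt I p).symm y :=
      ((contMDiffOn_extChartAt_symm (I := I) (n := ∞) p).contMDiffAt
        (ho.mem_nhds hy)).mdifferentiableAt (by simp)
    rw [← mfderiv_eq_fderiv, mfderiv_comp y (hf.mdifferentiable (by simp) _) h1]
    ext v
    exact h _ _
  have h2 := ho.isOpen_inter_preimage_of_fderiv_eq_zero hd hz {f p}
  have h3 : (extChartAt I p).target ∩ (f ∘ (extChartAt I p).symm) ⁻¹' {f p}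
      ∈ 𝓝 (extChartAt I p p) := h2.mem_nhds ⟨mem_extChartAt_target p, by simp⟩
  filter_upwards [(continuousAt_extChartAt (I := I) p).preimage_mem_nhds h3,
    extChartAt_source_mem_nhds (I := I) p] with q hq hqs
  have h4 := hq.2
  simp only [mem_preimage, Function.comp_apply, mem_singleton_iff,
    (extChartAt I p).left_inv hqs] at h4
  exact h4

end Chart

/-! ### Warped products of manifolds in product charts -/

section Product

variable {E₁ : Type*} [NormedAddCommGroup E₁] [NormedSpace ℝ E₁]
  {H₁ : Type*} [TopologicalSpace H₁] {I₁ : ModelWithCorners ℝ E₁ H₁} [I₁.Boundaryless]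
  {M₁ : Type*} [TopologicalSpace M₁] [ChartedSpace H₁ M₁] [IsManifold I₁ ∞ M₁]
  {E₂ : Type*} [NormedAddCommGroup E₂] [NormedSpace ℝ E₂]
  {H₂ : Type*} [TopologicalSpace H₂] {I₂ : ModelWithCorners ℝ E₂ H₂} [I₂.Boundaryless]
  {M₂ : Type*} [TopologicalSpace M₂] [ChartedSpace H₂ M₂] [IsManifold I₂ ∞ M₂]

theorem PseudoRiemannianMetric.isWarpedOn_inChart (g₁ : PseudoRiemannianMetric I₁ M₁)
    (g₂ : PseudoRiemannianMetric I₂ M₂) (f : M₁ → ℝ) (hf : ContMDiff I₁ 𝓘(ℝ, ℝ) ∞ f)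
    (hpos : ∀ p, 0 < f p) (p : M₁) (q : M₂) :
    LocalGeometry.IsWarpedOn (g₁.inChart p) (extChartAt I₁ p).target
      (g₂.inChart q) (extChartAt I₂ q).target (f ∘ (extChartAt I₁ p).symm)
      ((g₁.warpedProduct g₂ f hf hpos).inChart (p, q)) where
  left := g₁.isMetricOn_inChart p
  right := g₂.isMetricOn_inChart q
  smooth := contDiffOn_comp_extChartAt_symm hf p
  pos _ _ := hpos _
  total := by
    have h := (g₁.warpedProduct g₂ f hf hpos).isMetricOn_inChart (p, q)
    rwa [extChartAt_prod] at h
  apply_eq x hx y hy u v := by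
    have h := tensorInChart_warpedTensor g₁ g₂ f (p, q) (x, y) hx hy
    exact congrArg (fun B : E₁ × E₂ →L[ℝ] E₁ × E₂ →L[ℝ] ℝ => B u v) h

variable [FiniteDimensional ℝ E₁] [FiniteDimensional ℝ E₂]

theorem PseudoRiemannianMetric.codazziDefect_warpedProduct_eq_zero
    (hdim : 3 ≤ Module.finrank ℝ E₁ + Module.finrank ℝ E₂)
    (g₁ : PseudoRiemannianMetric I₁ M₁) (g₂ : PseudoRiemannianMetric I₂ M₂)
    (f : M₁ → ℝ) (hf : ContMDiff I₁ 𝓘(ℝ, ℝ) ∞ f) (hpos : ∀ p, 0 < f p)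
    (hC : (g₁.warpedProduct g₂ f hf hpos).ConcircularDivergenceFree) (p : M₁) (q : M₂)
    (X Y Z : E₁ × E₂) :
    LocalGeometry.codazziDefect ((g₁.warpedProduct g₂ f hf hpos).inChart (p, q))
      (LocalGeometry.ricci ((g₁.warpedProduct g₂ f hf hpos).inChart (p, q)))
      (extChartAt I₁ p p, extChartAt I₂ q q) X Y Z = 0 := by
  refine (g₁.isWarpedOn_inChart g₂ f hf hpos p q).total.codazziDefect_ricci_eq_zero
    (mk_mem_prod (mem_extChartAt_target p) (mem_extChartAt_target q))
    (by rwa [Module.finrank_prod]) (fun X Y Z => ?_) X Y Z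
  have h := hC (p, q) X Y Z
  unfold PseudoRiemannianMetric.divConcircular at h
  rw [extChartAt_prod] at h
  exact h

end Product

end

theorem mainTheorem4
    {E₁ : Type*} [NormedAddCommGroup E₁] [NormedSpace ℝ E₁] [FiniteDimensional ℝ E₁]
    {H₁ : Type*} [TopologicalSpace H₁] {I₁ : ModelWithCorners ℝ E₁ H₁} [I₁.Boundaryless]
    {M₁ : Type*} [TopologicalSpace M₁] [ChartedSpace H₁ M₁] [IsManifold I₁ ∞ M₁]
    {E₂ : Type*} [NormedAddCommGroup E₂] [NormedSpace ℝ E₂] [FiniteDimensional ℝ E₂]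
    {H₂ : Type*} [TopologicalSpace H₂] {I₂ : ModelWithCorners ℝ E₂ H₂} [I₂.Boundaryless]
    {M₂ : Type*} [TopologicalSpace M₂] [ChartedSpace H₂ M₂] [IsManifold I₂ ∞ M₂]
    [ConnectedSpace M₁] [Nonempty M₂]
    (hdim : 3 ≤ Module.finrank ℝ E₁ + Module.finrank ℝ E₂)
    (g₁ : PseudoRiemannianMetric I₁ M₁) (g₂ : PseudoRiemannianMetric I₂ M₂)
    (f : M₁ → ℝ) (hf : ContMDiff I₁ 𝓘(ℝ, ℝ) ∞ f) (hpos : ∀ p, 0 < f p)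
    (hC : (g₁.warpedProduct g₂ f hf hpos).ConcircularDivergenceFree) :
    ((∀ (p : M₁) (X Y Z : TangentSpace I₁ p),
        g₁.val p (g₁.riemann p X Y (g₁.grad f p)) Z =
          dirDeriv I₁ f p Y * ((1 / f p) * g₁.hessian f p X Z)
            - dirDeriv I₁ f p X * ((1 / f p) * g₁.hessian f p Y Z)) →
      g₁.ConcircularDivergenceFree) ∧
    g₂.ConcircularDivergenceFree ∧
    ((∃ c : ℝ, ∀ p : M₁, f p = c) ∨ g₂.IsEinstein) := by
  have hD := g₁.codazziDefect_warpedProduct_eq_zero hdim g₂ f hf hpos hC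
  have hW := g₁.isWarpedOn_inChart g₂ f hf hpos
  have hx : ∀ p : M₁, extChartAt I₁ p p ∈ (extChartAt I₁ p).target := mem_extChartAt_target
  have hy : ∀ q : M₂, extChartAt I₂ q q ∈ (extChartAt I₂ q).target := mem_extChartAt_target
  -- The Codazzi equations live at pairs of points; p₀ and q₀ complete a point of one factor to such
  -- a pair.
  obtain ⟨p₀⟩ : Nonempty M₁ := inferInstance
  obtain ⟨q₀⟩ : Nonempty M₂ := inferInstance
  have hfp : ∀ p, (f ∘ (extChartAt I₁ p).symm) (extChartAt I₁ p p) = f p := fun p => by simp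
  have hdf : ∀ (p : M₁) (X : E₁), dirDeriv I₁ f p X = f p *
      LocalGeometry.logDifferential (f ∘ (extChartAt I₁ p).symm) (extChartAt I₁ p p) X :=
    fun p X => by
      rw [dirDeriv_eq_fderiv hf p X, (hW p q₀).fderiv_warping (hx p), hfp]
  refine ⟨fun hR p X Y Z => ?_, fun q X Y Z => ?_, ?_⟩
  · refine (hW p q₀).left.divergence_concircular_eq_zero (hx p) (fun X Y Z => ?_) X Y Z
    have h1 := (hW p q₀).codazziDefect_base (hx p) (hy q₀) X Y Z
    rw [hD, (hW p q₀).left.codazziDefect_hessianRatio (hW p q₀).smooth (hW p q₀).pos (hx p)] at h1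
    have h2 : g₁.inChart p (extChartAt I₁ p p)
        (LocalGeometry.riemann (g₁.inChart p) (extChartAt I₁ p p) X Y
          (LocalGeometry.grad (g₁.inChart p) (f ∘ (extChartAt I₁ p).symm) (extChartAt I₁ p p))) Z
        = dirDeriv I₁ f p Y * ((1 / f p) * g₁.hessian f p X Z)
            - dirDeriv I₁ f p X * ((1 / f p) * g₁.hessian f p Y Z) := by
      rw [g₁.inChart_self]
      exact hR p X Y Z
    have h3 : ∀ X Z : E₁, (1 / f p) * g₁.hessian f p X Z
        = LocalGeometry.hessianRatio (g₁.inChart p) (f ∘ (extChartAt I₁ p).symm)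
          (extChartAt I₁ p p) X Z := fun X Z => by
      unfold PseudoRiemannianMetric.hessian
      rw [(hW p q₀).left.hessian_eq (hW p q₀).smooth (hW p q₀).pos (hx p), hfp, one_div,
        inv_mul_cancel_left₀ (hpos p).ne']
    rw [(hW p q₀).left.riemann_skew (hx p),
      (hW p q₀).left.apply_grad (hW p q₀).smooth (hW p q₀).pos (hx p), hfp, h3, h3, hdf, hdf] at h2
    -- After moving R(X, Y) off grad f by skewness, the curvature hypothesis says that f times the
    -- Codazzi defect of (1/f) H^f vanishes.
    have h4 : f p * (LocalGeometry.logDifferential (f ∘ (extChartAt I₁ p).symm)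
          (extChartAt I₁ p p) (LocalGeometry.riemann (g₁.inChart p) (extChartAt I₁ p p) X Y Z)
        + LocalGeometry.logDifferential (f ∘ (extChartAt I₁ p).symm) (extChartAt I₁ p p) Y
          * LocalGeometry.hessianRatio (g₁.inChart p) (f ∘ (extChartAt I₁ p).symm)
            (extChartAt I₁ p p) X Z
        - LocalGeometry.logDifferential (f ∘ (extChartAt I₁ p).symm) (extChartAt I₁ p p) X
          * LocalGeometry.hessianRatio (g₁.inChart p) (f ∘ (extChartAt I₁ p).symm)
            (extChartAt I₁ p p) Y Z) = 0 := by linarith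
    rw [(mul_eq_zero.1 h4).resolve_left (hpos p).ne', mul_zero, sub_zero] at h1
    exact h1.symm
  · refine (hW p₀ q).right.divergence_concircular_eq_zero (hy q) (fun X Y Z => ?_) X Y Z
    rw [← (hW p₀ q).codazziDefect_fibre (hx p₀) (hy q), hD]
  · by_cases h0 : ∀ (p : M₁) (X : TangentSpace I₁ p), dirDeriv I₁ f p X = 0
    · exact Or.inl (exists_eq_const_of_dirDeriv_eq_zero hf h0)
    · obtain ⟨p, X, hX⟩ : ∃ (p : M₁) (X : E₁), dirDeriv I₁ f p X ≠ 0 := by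
        push Not at h0
        exact h0
      rw [hdf p X] at hX
      have hL := right_ne_zero_of_mul hX
      -- The point p and the vector X are fixed before q varies, so one constant serves all of M₂,
      -- connected or not.
      have key : ∃ c : ℝ, ∀ (q : M₂) (V W : E₂),
          LocalGeometry.ricci (g₂.inChart q) (extChartAt I₂ q q) V W
            = c * g₂.inChart q (extChartAt I₂ q q) V W := by
        set x := extChartAt I₁ p p
        set F := f ∘ (extChartAt I₁ p).symm
        set n := Module.finrank ℝ E₂
        -- The constant is obtained by solving the vanishing of `codazziDefect_mixed` for Ric²,
        -- dividing by X(log f) ≠ 0.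
        refine ⟨(LocalGeometry.logDifferential F x X
            * LocalGeometry.warpingTerm (g₁.inChart p) F n x
          - fderiv ℝ (LocalGeometry.warpingTerm (g₁.inChart p) F n) x X
          - F x * (LocalGeometry.ricci (g₁.inChart p) x X (LocalGeometry.grad (g₁.inChart p) F x)
            - n * LocalGeometry.hessianRatio (g₁.inChart p) F x X
              (LocalGeometry.grad (g₁.inChart p) F x))) / LocalGeometry.logDifferential F x X,
          fun q V W => ?_⟩
        have h1 := (hW p q).codazziDefect_mixed (hx p) (hy q) X V W
        rw [hD] at h1
        rw [div_mul_eq_mul_div, eq_div_iff hL]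
        linarith
      obtain ⟨c, hc⟩ := key
      exact Or.inr ⟨c, fun q V W =>
        (hc q V W).trans (congrArg (c * ·) (g₂.inChart_self q V W))⟩
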